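/- **Theorem 2.** *Setting.* Fix integers $N,r$. For every horizon $T$, units $1\le i\le N$ are observed at times $1\le t\le T$, and an intervention takes place at time $T_0=T_0(T)$, where $T_0/T\to\rho\in(0,1)$ as $T\to\infty$. All quantities below except $N,r,\bm\Lambda,\sigma_i,\bm\alpha_0,\rho,d$ may depend on $T$. The observed outcome $Y_{it}$ equals $Y_{it}(0)$ for $t\le T_0$ and $Y_{it}(1)$ for $t>T_0$, and $$Y_{it}(0)=\bm\lambda_i^{\mathsf T}\bm F_t+\varepsilon_{it},\qquad Y_{it}(1)=Y_{it}(0)+\beta_{it},\qquad E(\varepsilon_{it}\mid \bm F_t)=0,$$ with random factors $\bm F_t\in\mathbb R^r$, fixed loadings $\bm\Lambda=(\bm\lambda_1,\dots,\bm\lambda_N)^{\mathsf T}$ and non-random effects $\bm\beta_t=(\beta_{1t},\dots,\beta_{Nt})^{\mathsf T}$. Write $\bm\alpha_t=E(\bm F_t)$, $\bm\tau_t=\bm\beta_t+\bm\Lambda\bm\alpha_t$, $\mathcal C_t=\{i:\beta_{it}=0\}$. Assume: 1. $\bm\alpha_t=\bm\alpha_0$ for $t\le T_0$ (for $t>T_0$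 it may vary); $\operatorname{Var}(\bm F_t)=\mathbf I_r$; $\operatorname{Var}(\bm\varepsilon_t)=\bm\Sigma=\operatorname{diag}(\sigma_1^2,\dots,\sigma_N^2)$ with $\sigma_i>0$; $\bm\Lambda^{\mathsf T}\bm\Sigma^{-1}\bm\Lambda$ is diagonal with nonzero diagonal entries. 2. $|\mathcal C_t|\ge\lfloor N/2\rfloor+r$ for all $T_0<t\le T$. 3. The process $(\bm F_t-\bm\alpha_t,\bm\varepsilon_t)_{1\le t\le T}$ is strictly stationary with a law that does not depend on $T$, and for some $\delta>0$ it has finite moments of order $4+2\delta$ and strong mixing coefficients $\alpha(k)$ (suprema over all horizons) with $\sum_k\alpha(k)^{\delta/(2+\delta)}<\infty$. 4. After deletion of any row of $\bm\Lambda$ there remain two disjoint $r\times r$ submatrices of rank $r$. Moreover, for each $T_0<t\le T$, the loadings of any $|\mathcal C_t|+\lfloor N/2\rfloor+1-N$ or more units of $\mathcal C_t$ span $\mathbb R^r$ (by 2 this number is at least $r$, so this holds if every $r$ rows of $\bm\Lambda$ are linearly independent). *Estimators.* Let $0<d\le 1/2$ and let $t=t(T)$ with $T_0<t\le T$ be a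 post-intervention time at which $\bm\alpha_t$ is bounded in $T$ and the nonzero effects are bounded away from zero: there is $c>0$ such that $|\beta_{it}|\ge c$ for all large $T$ and all $i\notin\mathcal C_t$. (This is automatic if $\bm\alpha_t$ and $\bm\beta_t$ do not depend on $T$.) Let $\hat{\bm\tau}_t$ be an estimator with $\hat{\bm\tau}_t-\bm\tau_t=O_p(T^{-d})$. Let $\bar{\bm Y}=T_0^{-1}\sum_{s\le T_0}\bm Y_s$ and $\hat{\bm V}=T_0^{-1}\sum_{s\le T_0}(\bm Y_s-\bar{\bm Y})(\bm Y_s-\bar{\bm Y})^{\mathsf T}$. Let $\hat{\bm\Lambda}=(\hat{\bm\lambda}_1,\dots,\hat{\bm\lambda}_N)^{\mathsf T}$ be the maximum likelihood factor analysis estimator from the pre-intervention data, that is, whenever a minimizer exists, $(\hat{\bm\Lambda},\hat{\bm\Psi})$ minimizes $$\log\det(\bm L\bm L^{\mathsf T}+\bm\Psi)+\operatorname{tr}\{\hat{\bm V}(\bm L\bm L^{\mathsf T}+\bm\Psi)^{-1}\}$$ over $\bm L\in\mathbb R^{N\times r}$ and positive diagonal $\bm\Psi$, with $\hat{\bm\Lambda}^{\mathsf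 T}\hat{\bm\Psi}^{-1}\hat{\bm\Lambda}$ diagonal. Let $\hat{\bm\alpha}_t$ be any minimizer over $\bm a\in\mathbb R^r$ of the sum of the $\lfloor N/2\rfloor+1$ smallest among the squared residuals $(\hat\tau_{it}-\hat{\bm\lambda}_i^{\mathsf T}\bm a)^2$, $1\le i\le N$. Put $\hat{\bm\beta}_t=\hat{\bm\tau}_t-\hat{\bm\Lambda}\hat{\bm\alpha}_t$ and $$\hat{\mathcal C}_t=\bigl\{i:|\hat\tau_{it}-\hat{\bm\lambda}_i^{\mathsf T}\hat{\bm\alpha}_t|\le\{2\log(NT)\}^{1/2}\hat\sigma/T^{d}\bigr\},\qquad \hat\sigma^2=N^{-1}\sum_{i=\lceil N/2\rceil-r}^N\nu_i(\hat{\bm V}),$$ where $\nu_i(\hat{\bm V})$ is the $i$th largest eigenvalue of $\hat{\bm V}$. *Conclusion.* As $T\to\infty$, $\hat{\bm\beta}_t-\bm\beta_t=O_p(T^{-d})$ (entrywise) and $\Pr(\hat{\mathcal C}_t=\mathcal C_t)\to1$. -/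

import Mathlib

open MeasureTheory ProbabilityTheory Filter Topology

noncomputable section

namespace SCI

/-- A sequence of random variables is bounded in probability by the deterministic rate `b`:
`A T = O_p (b T)` as `T → ∞`. -/
def IsBigOp {Ω : Type*} [MeasurableSpace Ω] (μ : Measure Ω) (A : ℕ → Ω → ℝ) (b : ℕ → ℝ) : Prop :=
  ∀ η : ℝ, 0 < η → ∃ M : ℝ, ∀ᶠ T in atTop, μ.real {ω | M * b T < |A T ω|} ≤ η

/-- Strong mixing coefficient of two sub-σ-algebras:
`sup |P(A ∩ B) - P(A) P(B)|` over `A ∈ m₁`, `B ∈ m₂`. -/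
def alphaCoef {Ω : Type*} [MeasurableSpace Ω] (μ : Measure Ω) (m₁ m₂ : MeasurableSpace Ω) : ℝ :=
  sSup {x : ℝ | ∃ A B : Set Ω, MeasurableSet[m₁] A ∧ MeasurableSet[m₂] B ∧
    x = |μ.real (A ∩ B) - μ.real A * μ.real B|}

/-- σ-algebra generated by `Z t` for `a ≤ t ≤ b`. -/
abbrev sigmaBlock {Ω E : Type*} [MeasurableSpace E] (Z : ℕ → Ω → E) (a b : ℕ) : MeasurableSpace Ω :=
  ⨆ t ∈ Set.Icc a b, MeasurableSpace.comap (Z t) inferInstance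

/-- The `k`-th strong mixing coefficient of the array `(Z T t)`, `1 ≤ t ≤ T`: the supremum over
horizons `T` and times `s` of the coefficient between `Z T 1, …, Z T s` and
`Z T (s + k), …, Z T T`. -/
def mixingCoef {Ω E : Type*} [MeasurableSpace Ω] [MeasurableSpace E] (μ : Measure Ω)
    (Z : ℕ → ℕ → Ω → E) (k : ℕ) : ℝ :=
  ⨆ p : ℕ × ℕ, alphaCoef μ (sigmaBlock (Z p.1) 1 p.2) (sigmaBlock (Z p.1) (p.2 + k) p.1)

/-- The quantities of the panel with `N` units and `r` factors. The asymptotics run along the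
horizon `T`; the observed periods are `1 ≤ t ≤ T`, the intervention takes place at `T0 T`, and
everything else that may change with it carries the index `T` as well. -/
structure Panel (Ω : Type*) (N r : ℕ) where
  /-- number of pre-intervention periods -/
  T0 : ℕ → ℕ
  /-- potential outcomes without the intervention -/
  Y0 : ℕ → ℕ → Ω → Fin N → ℝ
  /-- potential outcomes under the intervention -/
  Y1 : ℕ → ℕ → Ω → Fin N → ℝ
  /-- observed outcomes -/
  Y : ℕ → ℕ → Ω → Fin N → ℝ
  /-- latent factors -/
  F : ℕ → ℕ → Ω → Fin r → ℝ
  /-- random errors -/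
  ε : ℕ → ℕ → Ω → Fin N → ℝ
  /-- effects of the intervention -/
  β : ℕ → ℕ → Fin N → ℝ
  /-- factor loadings -/
  Λ : Matrix (Fin N) (Fin r) ℝ
  /-- error standard deviations -/
  σ : Fin N → ℝ

namespace Panel

variable {Ω : Type*} {N r : ℕ}

/-- Indicator of the intervention. -/
def X (P : Panel Ω N r) (T t : ℕ) : ℕ := if P.T0 T < t then 1 else 0

/-- Consistency: the observed outcome is the potential outcome of the received intervention. -/
def Consistency (P : Panel Ω N r) : Prop :=
  ∀ T t, 1 ≤ t → t ≤ T → ∀ ω i,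
    (P.X T t = 0 → P.Y T t ω i = P.Y0 T t ω i) ∧ (P.X T t = 1 → P.Y T t ω i = P.Y1 T t ω i)

/-- Linear factor model, with errors that have conditional mean zero given the factors. -/
def LinearFactorModel [MeasurableSpace Ω] (P : Panel Ω N r) (μ : Measure Ω) : Prop :=
  ∀ T t, 1 ≤ t → t ≤ T →
    Measurable (P.F T t) ∧ Measurable (P.ε T t) ∧
    (∀ ω i, P.Y0 T t ω i = P.Λ.row i ⬝ᵥ P.F T t ω + P.ε T t ω i) ∧
    (∀ ω i, P.Y1 T t ω i = P.Y0 T t ω i + P.β T t i) ∧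
    (∀ i, Integrable (fun ω => P.ε T t ω i) μ ∧
      μ[fun ω => P.ε T t ω i | MeasurableSpace.comap (P.F T t) inferInstance] =ᵐ[μ] 0)

/-- `α_t = E(F_t)`. -/
def factorMean [MeasurableSpace Ω] (P : Panel Ω N r) (μ : Measure Ω) (T t : ℕ) : Fin r → ℝ :=
  fun k => ∫ ω, P.F T t ω k ∂μ

/-- Constant factor mean before the intervention, unit factor covariance, diagonal error
covariance, and the normalization of the loadings. -/
def FactorMoments [MeasurableSpace Ω] (P : Panel Ω N r) (μ : Measure Ω) : Prop :=
  (∃ α₀ : Fin r → ℝ, ∀ T t, 1 ≤ t → t ≤ T → t ≤ P.T0 T → P.factorMean μ T t = α₀) ∧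
  (∀ i, 0 < P.σ i) ∧
  (∀ T t, 1 ≤ t → t ≤ T →
    (∀ i, MemLp (fun ω => P.ε T t ω i) 2 μ) ∧
    (∀ k, MemLp (fun ω => P.F T t ω k) 2 μ) ∧
    (∀ i j, covariance (fun ω => P.ε T t ω i) (fun ω => P.ε T t ω j) μ =
      (Matrix.diagonal fun i => P.σ i ^ 2) i j) ∧
    (∀ k l, covariance (fun ω => P.F T t ω k) (fun ω => P.F T t ω l) μ =
      (1 : Matrix (Fin r) (Fin r) ℝ) k l)) ∧
  (P.Λ.transpose * (Matrix.diagonal fun i => P.σ i ^ 2)⁻¹ * P.Λ).IsDiag ∧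
  (∀ k, (P.Λ.transpose * (Matrix.diagonal fun i => P.σ i ^ 2)⁻¹ * P.Λ) k k ≠ 0)

/-- `C_t`, the set of units without effect at time `t`. -/
def controls (P : Panel Ω N r) (T t : ℕ) : Finset (Fin N) :=
  open Classical in Finset.univ.filter fun i => P.β T t i = 0

/-- At least `⌊N/2⌋ + r` valid controls at each post-intervention time. -/
def MajorityControls (P : Panel Ω N r) : Prop :=
  ∀ T t, P.T0 T < t → t ≤ T → N / 2 + r ≤ (P.controls T t).card

/-- The centred process `(F_t - E F_t, ε_t)`. -/
def centred [MeasurableSpace Ω] (P : Panel Ω N r) (μ : Measure Ω) (T t : ℕ) (ω : Ω) :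
    (Fin r → ℝ) × (Fin N → ℝ) :=
  (P.F T t ω - P.factorMean μ T t, P.ε T t ω)

/-- The centred process is strictly stationary, with a law that does not change with the horizon,
has finite moments of order `4 + 2δ`, and is strongly mixing with
`∑ α(k) ^ (δ / (2 + δ)) < ∞`. -/
def StationaryMixing [MeasurableSpace Ω] (P : Panel Ω N r) (μ : Measure Ω) : Prop :=
  (∀ n T T' s s' : ℕ, s + n ≤ T → s' + n ≤ T' →
    IdentDistrib (fun ω (j : Fin n) => P.centred μ T (s + 1 + j) ω)
      (fun ω (j : Fin n) => P.centred μ T' (s' + 1 + j) ω) μ μ) ∧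
  ∃ δ : ℝ, 0 < δ ∧
    (∀ T t, 1 ≤ t → t ≤ T →
      (∀ k, MemLp (fun ω => (P.centred μ T t ω).1 k) (ENNReal.ofReal (4 + 2 * δ)) μ) ∧
      (∀ i, MemLp (fun ω => (P.centred μ T t ω).2 i) (ENNReal.ofReal (4 + 2 * δ)) μ)) ∧
    Summable fun k => mixingCoef μ (P.centred μ) k ^ (δ / (2 + δ))

/-- The Anderson–Rubin rank condition: after deleting any row of the loading matrix there remain
two disjoint `r × r` submatrices of rank `r`. -/
def AndersonRubin (P : Panel Ω N r) : Prop :=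
  ∀ i : Fin N, ∃ A B : Finset (Fin N), i ∉ A ∧ i ∉ B ∧ Disjoint A B ∧ A.card = r ∧ B.card = r ∧
    LinearIndependent ℝ (fun j : A => P.Λ.row j) ∧ LinearIndependent ℝ (fun j : B => P.Λ.row j)

/-- The loadings of the valid controls are in general position, as far as trimmed regression needs
it: the loadings of any `|C_t| + ⌊N/2⌋ + 1 - N` or more valid controls span `ℝ^r`. With at least
`⌊N/2⌋ + r` valid controls this number is at least `r`, so that the property holds in particular
when every `r` rows of the loading matrix are linearly independent. -/
def GeneralPosition (P : Panel Ω N r) : Prop :=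
  ∀ T t, P.T0 T < t → t ≤ T → ∀ S ⊆ P.controls T t,
    (P.controls T t).card + N / 2 + 1 ≤ N + S.card →
      Submodule.span ℝ (P.Λ.row '' (S : Set (Fin N))) = ⊤

/-- The trend `τ_t = β_t + Λ α_t`. -/
def trend [MeasurableSpace Ω] (P : Panel Ω N r) (μ : Measure Ω) (T t : ℕ) : Fin N → ℝ :=
  P.β T t + P.Λ.mulVec (P.factorMean μ T t)

/-- Mean of the pre-intervention outcomes. -/
def preMean (P : Panel Ω N r) (T : ℕ) (ω : Ω) : Fin N → ℝ :=
  (P.T0 T : ℝ)⁻¹ • ∑ t ∈ Finset.Icc 1 (P.T0 T), P.Y T t ω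

/-- `V̂`, the sample covariance matrix of the pre-intervention outcomes. -/
def preCov (P : Panel Ω N r) (T : ℕ) (ω : Ω) : Matrix (Fin N) (Fin N) ℝ :=
  (P.T0 T : ℝ)⁻¹ • ∑ t ∈ Finset.Icc 1 (P.T0 T),
    Matrix.vecMulVec (P.Y T t ω - P.preMean T ω) (P.Y T t ω - P.preMean T ω)

theorem preCov_isHermitian (P : Panel Ω N r) (T : ℕ) (ω : Ω) : (P.preCov T ω).IsHermitian := by
  ext i j
  simp [preCov, Matrix.sum_apply, Matrix.vecMulVec_apply, mul_comm]

/-- `σ̂ = (N⁻¹ ∑_{i = ⌈N/2⌉ - r}^N ν_i(V̂))^{1/2}`, with `ν_i` the `i`-th largest eigenvalue.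
Mathlib's `eigenvalues₀` lists the eigenvalues in decreasing order, starting at index `0`. -/
def sigmaHat (P : Panel Ω N r) (T : ℕ) (ω : Ω) : ℝ :=
  √((N : ℝ)⁻¹ * ∑ j : Fin (Fintype.card (Fin N)) with (N + 1) / 2 ≤ j.val + 1 + r,
    (P.preCov_isHermitian T ω).eigenvalues₀ j)

end Panel

/-- Negative Gaussian log-likelihood (up to constants) of the factor model with loadings `L` and
error variances `ψ`, at the sample covariance matrix `S`. -/
def factorObjective {N r : ℕ} (S : Matrix (Fin N) (Fin N) ℝ) (L : Matrix (Fin N) (Fin r) ℝ)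
    (ψ : Fin N → ℝ) : ℝ :=
  Real.log (L * L.transpose + Matrix.diagonal ψ).det +
    (S * (L * L.transpose + Matrix.diagonal ψ)⁻¹).trace

/-- `(L, ψ)` is a maximum likelihood solution of factor analysis at `S`, normalized so that
`Lᵀ diag(ψ)⁻¹ L` is diagonal. -/
def IsFactorMLE {N r : ℕ} (S : Matrix (Fin N) (Fin N) ℝ) (L : Matrix (Fin N) (Fin r) ℝ)
    (ψ : Fin N → ℝ) : Prop :=
  (∀ i, 0 < ψ i) ∧ (L.transpose * (Matrix.diagonal ψ)⁻¹ * L).IsDiag ∧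
  ∀ (L' : Matrix (Fin N) (Fin r) ℝ) (ψ' : Fin N → ℝ), (∀ i, 0 < ψ' i) →
    factorObjective S L ψ ≤ factorObjective S L' ψ'

/-- Sum of the `⌊N/2⌋ + 1` smallest squared residuals of the regression of `y` on `L`. -/
def ltsObjective {N r : ℕ} (L : Matrix (Fin N) (Fin r) ℝ) (y : Fin N → ℝ) (a : Fin r → ℝ) : ℝ :=
  let res : Fin N → ℝ := fun i => (y i - L.row i ⬝ᵥ a) ^ 2
  ∑ i : Fin N with i.val < N / 2 + 1, res (Tuple.sort res i)

/-- `a` is a least trimmed squares solution. -/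
def IsLTS {N r : ℕ} (L : Matrix (Fin N) (Fin r) ℝ) (y : Fin N → ℝ) (a : Fin r → ℝ) : Prop :=
  ∀ a', ltsObjective L y a ≤ ltsObjective L y a'

/-- The effect estimator `τ̂_t - Λ̂ α̂_t`. -/
def betaHat {N r : ℕ} (L : Matrix (Fin N) (Fin r) ℝ) (y : Fin N → ℝ) (a : Fin r → ℝ) :
    Fin N → ℝ :=
  y - L.mulVec a

/-- The hard-thresholding selection of units. -/
def selected {N r : ℕ} (L : Matrix (Fin N) (Fin r) ℝ) (y : Fin N → ℝ) (a : Fin r → ℝ)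
    (thr : ℝ) : Finset (Fin N) :=
  open Classical in Finset.univ.filter fun i => |y i - L.row i ⬝ᵥ a| ≤ thr

end SCI

end

/-! Randomness enters through two quantities only: the trend error, of order `T ^ (-d)` by
assumption, and the error of the sample covariance matrix, which is of order `T ^ (-1/2)` and hence
of order `T ^ (-d)`. Everything else is deterministic perturbation theory: if both errors are at
most a small `ε`, then the fitted effects are off by at most `C * ε`, with `C` depending only on the
loadings, the error variances and the bound on the factor mean (`exists_betaHat_bound`).

The deterministic chain has three links. The Gaussian objective grows quadratically around the true
covariance matrix, while changing the sample covariance by `ε` perturbs it linearly; so any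
parameter doing at least as well as the truth has an implied covariance matrix within `C * ε` of the
true one (`exists_bound_of_objective_le`). Under the Anderson–Rubin condition each error variance is
a ratio of two minors of that matrix, a smooth function near the truth; subtracting the variances
leaves the common part, which fixes the loadings up to an invertible `Q`
(`eventually_loadings_near`). Least trimmed squares is indifferent to `Q`. The controls alone make
its optimal value `O(ε ^ 2)`, so half the units plus one have residuals `O(ε)`; enough of these are
controls for their loadings to span, which pins down the coefficient (`exists_lts_bound`).

The covariance rate comes from Davydov's inequality (`abs_cov_le_rpow`): summable mixing
coefficients make the variance of a sample mean `O(1 / T)`, and Chebyshev's inequality finishes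
(`isBigOp_sample_mean`). Selection is consistent because the threshold, which carries the factor
`√(log T)`, eventually exceeds every multiple of `T ^ (-d)` and still tends to zero, as `sigmaHat`
stays between positive constants with probability tending to one. -/

namespace SCI

/-! ### Quadratic growth of the Gaussian objective around the true covariance matrix. -/

section Matrices

open Matrix

theorem exists_orthogonal_diagonalization {n : Type*} [Fintype n] [DecidableEq n]
    {H : Matrix n n ℝ} (hH : H.IsHermitian) :
    ∃ (U : Matrix n n ℝ), Uᵀ * U = 1 ∧ U * Uᵀ = 1 ∧ H = U * diagonal hH.eigenvalues * Uᵀ := by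
  refine ⟨hH.eigenvectorUnitary, ?_, ?_, ?_⟩
  · exact Unitary.coe_star_mul_self hH.eigenvectorUnitary
  · exact Unitary.coe_mul_star_self hH.eigenvectorUnitary
  · have := hH.spectral_theorem
    rw [Unitary.conjStarAlgAut_apply] at this
    exact this

theorem abs_entry_le_one_of_orthogonal {n : Type*} [Fintype n] [DecidableEq n]
    {U : Matrix n n ℝ} (hU : U * Uᵀ = 1) (i j : n) :
    |U i j| ≤ 1 := by
  have h : ∑ k, U i k * U i k = 1 := by
    have := congrFun (congrFun hU i) i
    simpa [Matrix.mul_apply] using this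
  have h2 : U i j * U i j ≤ 1 := by
    rw [← h]
    exact Finset.single_le_sum (f := fun k => U i k * U i k)
      (fun k _ => mul_self_nonneg _) (Finset.mem_univ j)
  exact abs_le_one_iff_mul_self_le_one.mpr h2

theorem abs_entry_conj_diagonal_le {n m : Type*} [Fintype m] [DecidableEq m]
    {U : Matrix n m ℝ} (hU : ∀ i j, |U i j| ≤ 1)
    (x : m → ℝ) (i j : n) : |(U * diagonal x * Uᵀ) i j| ≤ ∑ k, |x k| := by
  rw [Matrix.mul_apply]
  simp only [Matrix.mul_diagonal, Matrix.transpose_apply]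
  refine (Finset.abs_sum_le_sum_abs _ _).trans (Finset.sum_le_sum fun k _ => ?_)
  rw [abs_mul, abs_mul]
  have h1 := hU i k
  have h2 := hU j k
  calc |U i k| * |x k| * |U j k| ≤ 1 * |x k| * 1 := by gcongr
    _ = |x k| := by ring

theorem abs_entry_mul_mul_le {l n m o : Type*} [Fintype n] [Fintype m]
    (A : Matrix l n ℝ) (X : Matrix n m ℝ)
    (B : Matrix m o ℝ) {e : ℝ} (hX : ∀ i j, |X i j| ≤ e) (i : l) (j : o) :
    |(A * X * B) i j| ≤ (∑ a, ∑ b, |A i a| * |B b j|) * e := by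
  have : (A * X * B) i j = ∑ a, ∑ b, A i a * X a b * B b j := by
    rw [Matrix.mul_apply]
    simp only [Matrix.mul_apply, Finset.sum_mul]
    rw [Finset.sum_comm]
  rw [this, Finset.sum_mul]
  refine (Finset.abs_sum_le_sum_abs _ _).trans (Finset.sum_le_sum fun a _ => ?_)
  rw [Finset.sum_mul]
  refine (Finset.abs_sum_le_sum_abs _ _).trans (Finset.sum_le_sum fun b _ => ?_)
  rw [abs_mul, abs_mul]
  have := hX a b
  calc |A i a| * |X a b| * |B b j| ≤ |A i a| * e * |B b j| := by gcongr
    _ = _ := by ring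

theorem exists_abs_entry_mul_mul_le {l n m o : Type*} [Fintype n] [Fintype m] [Finite l] [Finite o]
    (A : Matrix l n ℝ) (B : Matrix m o ℝ) :
    ∃ c : ℝ, 0 ≤ c ∧ ∀ (X : Matrix n m ℝ) (e : ℝ), 0 ≤ e → (∀ i j, |X i j| ≤ e) →
      ∀ i j, |(A * X * B) i j| ≤ c * e := by
  obtain ⟨c, hc⟩ := (Set.finite_range
    (fun p : l × o => ∑ a, ∑ b, |A p.1 a| * |B b p.2|)).bddAbove
  refine ⟨max c 0, le_max_right _ _, fun X e he hX i j => ?_⟩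
  refine (abs_entry_mul_mul_le A X B hX i j).trans (mul_le_mul_of_nonneg_right ?_ he)
  exact (hc ⟨(i, j), rfl⟩).trans (le_max_left _ _)

theorem abs_trace_mul_le {n : Type*} [Fintype n] (X Y : Matrix n n ℝ) {e f : ℝ} (he : 0 ≤ e)
    (hX : ∀ i j, |X i j| ≤ e) (hY : ∀ i j, |Y i j| ≤ f) :
    |(X * Y).trace| ≤ (Fintype.card n : ℝ) ^ 2 * (e * f) := by
  have : (X * Y).trace = ∑ i, ∑ j, X i j * Y j i := by
    simp [Matrix.trace, Matrix.mul_apply]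
  rw [this]
  calc |∑ i, ∑ j, X i j * Y j i| ≤ ∑ i : n, ∑ j : n, e * f := by
        refine (Finset.abs_sum_le_sum_abs _ _).trans (Finset.sum_le_sum fun a _ => ?_)
        refine (Finset.abs_sum_le_sum_abs _ _).trans (Finset.sum_le_sum fun b _ => ?_)
        rw [abs_mul]
        exact mul_le_mul (hX a b) (hY b a) (abs_nonneg _) he
    _ = _ := by simp; ring

/-- The quadratic lower bound for `g - 1 - log g` in terms of the deviation of `√g` from `1`. -/
theorem sq_sqrt_sub_one_le {g : ℝ} (hg : 0 < g) : (√g - 1) ^ 2 ≤ g - 1 - Real.log g := by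
  have hs : 0 < √g := Real.sqrt_pos.mpr hg
  have h1 : Real.log g = 2 * Real.log √g := by rw [Real.log_sqrt hg.le]; ring
  have h2 := Real.log_le_sub_one_of_pos hs
  have h3 := Real.sq_sqrt hg.le
  nlinarith

/-- A quadratic form bounded by a small multiple of a linear one forces small entries. -/
theorem sum_le_of_sum_sq_le {ι : Type*} [Fintype ι] (u : ι → ℝ) (hu : ∀ i, 0 ≤ u i) {κ : ℝ}
    (hκ0 : 0 ≤ κ) (hκ : κ ≤ 1 / 2) (h : ∑ i, u i ^ 2 ≤ κ * ∑ i, u i * (u i + 2)) :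
    ∑ i, u i ≤ 4 * κ * Fintype.card ι := by
  have hs : 0 ≤ ∑ i, u i := Finset.sum_nonneg fun i _ => hu i
  have hq : 0 ≤ ∑ i, u i ^ 2 := Finset.sum_nonneg fun i _ => sq_nonneg _
  have h1 : ∑ i, u i * (u i + 2) = ∑ i, u i ^ 2 + 2 * ∑ i, u i := by
    rw [Finset.mul_sum, ← Finset.sum_add_distrib]
    exact Finset.sum_congr rfl fun i _ => by ring
  have h2 : (∑ i, u i) ^ 2 ≤ Fintype.card ι * ∑ i, u i ^ 2 := by
    simpa using sq_sum_le_card_mul_sum_sq (s := Finset.univ) (f := u)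
  rw [h1] at h
  have hc : (0 : ℝ) ≤ Fintype.card ι := Nat.cast_nonneg _
  have h3 : ∑ i, u i ^ 2 ≤ 4 * κ * ∑ i, u i := by nlinarith
  have h4 : (∑ i, u i) ^ 2 ≤ (4 * κ * Fintype.card ι) * ∑ i, u i :=
    h2.trans ((mul_le_mul_of_nonneg_left h3 hc).trans_eq (by ring))
  rcases hs.eq_or_lt with h0 | h0
  · rw [← h0]
    positivity
  · rw [sq] at h4
    exact le_of_mul_le_mul_right h4 h0

/-- If the Gaussian objective at `H` does not exceed its value at the identity, for a sample
covariance matrix `1 + E` close to the identity, then `H` is close to the identity. -/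
theorem abs_sub_one_le_of_objective_le {n : Type*} [Fintype n] [DecidableEq n]
    {H E : Matrix n n ℝ} (hH : H.PosDef) {e : ℝ} (he : 0 ≤ e)
    (hE : ∀ i j, |E i j| ≤ e) (hsmall : 4 * (Fintype.card n : ℝ) ^ 3 * e ≤ 1 / 2)
    (hobj : Real.log H.det + ((1 + E) * H⁻¹).trace ≤ (1 + E).trace) (i j : n) :
    |(H - 1) i j| ≤ 40 * (Fintype.card n : ℝ) ^ 3 * e := by
  obtain ⟨U, hU1, hU2, hUH⟩ := exists_orthogonal_diagonalization hH.1
  set h := hH.1.eigenvalues with hh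
  have hpos : ∀ k, 0 < h k := hH.eigenvalues_pos
  have hUe := abs_entry_le_one_of_orthogonal hU2
  have hinv : H⁻¹ = U * diagonal (fun k => (h k)⁻¹) * Uᵀ := by
    apply Matrix.inv_eq_right_inv
    rw [hUH]
    calc U * diagonal h * Uᵀ * (U * diagonal (fun k => (h k)⁻¹) * Uᵀ)
        = U * (diagonal h * (Uᵀ * U) * diagonal (fun k => (h k)⁻¹)) * Uᵀ := by
          simp only [Matrix.mul_assoc]
      _ = 1 := by
          rw [hU1, Matrix.mul_one, Matrix.diagonal_mul_diagonal]
          have : (fun k => h k * (h k)⁻¹) = fun _ => 1 := by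
            funext k; exact mul_inv_cancel₀ (hpos k).ne'
          rw [this, Matrix.diagonal_one, Matrix.mul_one, hU2]
  have hsub : ∀ x : n → ℝ, U * diagonal x * Uᵀ - 1 = U * diagonal (fun k => x k - 1) * Uᵀ := by
    intro x
    have : diagonal (fun k => x k - 1) = diagonal x - 1 := by
      rw [← Matrix.diagonal_one, Matrix.diagonal_sub]
    rw [this, Matrix.mul_sub, Matrix.sub_mul, Matrix.mul_one, hU2]
  -- The gain `g - 1 - log g` at an eigenvalue `g` of `H⁻¹` is at least `u ^ 2`, while `|g - 1| =
  -- |√g - 1| * |√g + 1|` is at most `u * (u + 2)`. Comparing a quadratic with a linear quantity in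
  -- `u` needs no a priori bound on the eigenvalues.
  set u : n → ℝ := fun k => |√(h k)⁻¹ - 1| with hu
  have hg : ∀ k, 0 < (h k)⁻¹ := fun k => inv_pos.mpr (hpos k)
  have hgu : ∀ k, |(h k)⁻¹ - 1| ≤ u k * (u k + 2) := by
    intro k
    have h1 : (h k)⁻¹ - 1 = (√(h k)⁻¹ - 1) * (√(h k)⁻¹ - 1 + 2) := by
      nlinarith [Real.sq_sqrt (hg k).le]
    rw [h1, abs_mul]
    exact mul_le_mul_of_nonneg_left ((abs_add_le _ _).trans (by simp [hu])) (abs_nonneg _)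
  have hlog : Real.log H.det = - ∑ k, Real.log (h k)⁻¹ := by
    rw [hH.1.det_eq_prod_eigenvalues]
    simp only [RCLike.ofReal_real_eq_id, id]
    rw [Real.log_prod fun k _ => (hpos k).ne']
    simp [Real.log_inv]
  have htr : H⁻¹.trace = ∑ k, (h k)⁻¹ := by
    rw [hinv, Matrix.trace_mul_comm, ← Matrix.mul_assoc, hU1, Matrix.one_mul,
      Matrix.trace_diagonal]
  have hEtr : |(E * (H⁻¹ - 1)).trace| ≤
      (Fintype.card n : ℝ) ^ 2 * (e * ∑ k, u k * (u k + 2)) := by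
    apply abs_trace_mul_le _ _ he hE
    intro a b
    rw [hinv, hsub]
    exact (abs_entry_conj_diagonal_le hUe _ a b).trans (Finset.sum_le_sum fun k _ => hgu k)
  -- Summing the gains gives `log det H + tr H⁻¹ - n`. After `tr E` cancels in the objective
  -- inequality, only `-tr (E * (H⁻¹ - 1))` remains on the other side, which is linear in `e`.
  have hkey : ∑ k, u k ^ 2 ≤ (Fintype.card n : ℝ) ^ 2 * e * ∑ k, u k * (u k + 2) := by
    have h1 : ∑ k, u k ^ 2 ≤ ∑ k, ((h k)⁻¹ - 1 - Real.log (h k)⁻¹) :=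
      Finset.sum_le_sum fun k _ => by
        simpa [hu, sq_abs] using sq_sqrt_sub_one_le (hg k)
    have h2 : ∑ k, ((h k)⁻¹ - 1 - Real.log (h k)⁻¹) =
        Real.log H.det + H⁻¹.trace - Fintype.card n := by
      rw [hlog, htr, Finset.sum_sub_distrib, Finset.sum_sub_distrib]
      simp only [Finset.sum_const, Finset.card_univ, nsmul_eq_mul, mul_one]
      ring
    have h3 : ((1 + E) * H⁻¹).trace = H⁻¹.trace + (E * (H⁻¹ - 1)).trace + E.trace := by
      rw [Matrix.add_mul, Matrix.mul_sub, Matrix.trace_add, Matrix.trace_sub, Matrix.one_mul,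
        Matrix.mul_one]
      ring
    rw [h3, Matrix.trace_add, Matrix.trace_one] at hobj
    have h4 := neg_abs_le (E * (H⁻¹ - 1)).trace
    rw [mul_assoc]
    linarith
  have hcard : (Fintype.card n : ℝ) ^ 2 ≤ (Fintype.card n : ℝ) ^ 3 := by
    exact_mod_cast (by
      rcases Nat.eq_zero_or_pos (Fintype.card n) with h0 | h0
      · simp [h0]
      · exact Nat.pow_le_pow_right h0 (by norm_num) :
        (Fintype.card n) ^ 2 ≤ (Fintype.card n) ^ 3)
  have hκ : (Fintype.card n : ℝ) ^ 2 * e ≤ 1 / 2 := by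
    have : (Fintype.card n : ℝ) ^ 2 * e ≤ (Fintype.card n : ℝ) ^ 3 * e := by gcongr
    have h0 : 0 ≤ (Fintype.card n : ℝ) ^ 3 * e := by positivity
    linarith
  have hu0 : ∀ k, 0 ≤ u k := fun k => abs_nonneg _
  have hsum := sum_le_of_sum_sq_le u hu0 (by positivity) hκ hkey
  have hsum' : ∑ k, u k ≤ 4 * (Fintype.card n : ℝ) ^ 3 * e := hsum.trans_eq (by ring)
  -- From `u ≤ 1/2` follow `h ≤ 4` and `u * (u + 2) ≤ 5/2 * u`; their product gives the factor 10.
  have hhu : ∀ k, |h k - 1| ≤ 10 * u k := by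
    intro k
    have huk : u k ≤ 1 / 2 :=
      (Finset.single_le_sum (fun k _ => hu0 k) (Finset.mem_univ k)).trans (hsum'.trans hsmall)
    have hs : 1 / 2 ≤ √(h k)⁻¹ := by
      have := (abs_le.mp huk).1
      linarith
    have hg4 : 1 / 4 ≤ (h k)⁻¹ := by nlinarith [Real.sq_sqrt (hg k).le]
    have hh4 : h k ≤ 4 := by
      rw [← inv_inv (h k)]
      exact (inv_anti₀ (by norm_num) hg4).trans_eq (by norm_num)
    have h1 : h k - 1 = -(h k * ((h k)⁻¹ - 1)) := by
      rw [mul_sub, mul_inv_cancel₀ (hpos k).ne']; ring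
    rw [h1, abs_neg, abs_mul, abs_of_pos (hpos k)]
    calc h k * |(h k)⁻¹ - 1| ≤ 4 * (u k * (u k + 2)) :=
          mul_le_mul hh4 (hgu k) (abs_nonneg _) (by norm_num)
      _ ≤ 10 * u k := by nlinarith [hu0 k]
  conv_lhs => rw [hUH, hsub]
  calc |(U * diagonal (fun k => h k - 1) * Uᵀ) i j| ≤ ∑ k, |h k - 1| :=
        abs_entry_conj_diagonal_le hUe _ i j
    _ ≤ ∑ k, 10 * u k := Finset.sum_le_sum fun k _ => hhu k
    _ = 10 * ∑ k, u k := by rw [Finset.mul_sum]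
    _ ≤ _ := by linarith

theorem exists_factorization_of_posDef {n : Type*} [Fintype n] [DecidableEq n]
    {V : Matrix n n ℝ} (hV : V.PosDef) :
    ∃ A B : Matrix n n ℝ, A * B = 1 ∧ B * A = 1 ∧ V = A * Aᵀ := by
  obtain ⟨U, hU1, hU2, hUH⟩ := exists_orthogonal_diagonalization hV.1
  set h := hV.1.eigenvalues
  have hpos : ∀ k, 0 < h k := hV.eigenvalues_pos
  have hAB : U * diagonal (fun k => √(h k)) * (diagonal (fun k => (√(h k))⁻¹) * Uᵀ) = 1 := by
    calc _ = U * (diagonal (fun k => √(h k)) * diagonal (fun k => (√(h k))⁻¹)) * Uᵀ := by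
          simp only [Matrix.mul_assoc]
      _ = 1 := by
          have : (fun k => √(h k) * (√(h k))⁻¹) = fun _ => 1 := by
            funext k; exact mul_inv_cancel₀ (Real.sqrt_pos.mpr (hpos k)).ne'
          rw [Matrix.diagonal_mul_diagonal, this, Matrix.diagonal_one, Matrix.mul_one, hU2]
  refine ⟨_, _, hAB, mul_eq_one_comm.mp hAB, ?_⟩
  rw [Matrix.transpose_mul, Matrix.diagonal_transpose]
  conv_lhs => rw [hUH]
  have : diagonal h = diagonal (fun k => √(h k)) * diagonal (fun k => √(h k)) := by
    rw [Matrix.diagonal_mul_diagonal]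
    congr 1
    funext k
    exact (Real.mul_self_sqrt (hpos k).le).symm
  rw [this]
  simp only [Matrix.mul_assoc]

/-- Whitening: writing `V = A * Aᵀ` and conjugating by `B = A⁻¹` turns `V` into the identity, shifts
the log-determinant by a constant and preserves the traces. The case of the identity then applies,
and conjugating back with `A` costs a fixed factor. -/
theorem exists_bound_of_objective_le {n : Type*} [Fintype n] [DecidableEq n]
    {V : Matrix n n ℝ} (hV : V.PosDef) :
    ∃ C ε₀ : ℝ, 0 < C ∧ 0 < ε₀ ∧ ∀ (M S : Matrix n n ℝ) (ε : ℝ), M.PosDef → 0 ≤ ε → ε ≤ ε₀ →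
      (∀ i j, |S i j - V i j| ≤ ε) →
      Real.log M.det + (S * M⁻¹).trace ≤ Real.log V.det + (S * V⁻¹).trace →
      ∀ i j, |M i j - V i j| ≤ C * ε := by
  obtain ⟨A, B, hAB, hBA, hVA⟩ := exists_factorization_of_posDef hV
  obtain ⟨b, hb0, hBb⟩ := exists_abs_entry_mul_mul_le B Bᵀ
  obtain ⟨a, ha0, hAa⟩ := exists_abs_entry_mul_mul_le A Aᵀ
  set c : ℝ := (Fintype.card n : ℝ) ^ 3 with hc
  have hc0 : 0 ≤ c := by positivity
  -- The radius makes `4 * c * (b * ε) ≤ 1/2`, as required near the identity; the summands 1 only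
  -- secure positivity.
  refine ⟨40 * a * b * c + 1, 1 / (8 * c * b + 1), by positivity, by positivity, ?_⟩
  intro M S ε hM hε0 hε hS hobj i j
  have hABt : Bᵀ * Aᵀ = 1 := by rw [← Matrix.transpose_mul, hAB, Matrix.transpose_one]
  have hBAt : Aᵀ * Bᵀ = 1 := by rw [← Matrix.transpose_mul, hBA, Matrix.transpose_one]
  set H := B * M * Bᵀ with hHdef
  have hinjB : Function.Injective B.vecMul := by
    intro x y hxy
    have := congrArg (fun z => z ᵥ* A) hxy
    simpa [Matrix.vecMul_vecMul, hBA] using this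
  have hH : H.PosDef := by
    have := hM.mul_mul_conjTranspose_same hinjB
    simpa [Matrix.conjTranspose_eq_transpose_of_trivial] using this
  have hMH : M = A * H * Aᵀ := by
    calc M = (A * B) * M * (Bᵀ * Aᵀ) := by rw [hAB, hABt, Matrix.one_mul, Matrix.mul_one]
      _ = _ := by simp only [hHdef, Matrix.mul_assoc]
  have hHinv : H * H⁻¹ = 1 := Matrix.mul_nonsing_inv _ (by
    exact isUnit_iff_ne_zero.mpr hH.det_pos.ne')
  have hMinv : M⁻¹ = Bᵀ * H⁻¹ * B := by
    apply Matrix.inv_eq_right_inv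
    rw [hMH]
    calc A * H * Aᵀ * (Bᵀ * H⁻¹ * B) = A * (H * (Aᵀ * Bᵀ) * H⁻¹) * B := by
          simp only [Matrix.mul_assoc]
      _ = 1 := by rw [hBAt, Matrix.mul_one, hHinv, Matrix.mul_one, hAB]
  have hVinv : V⁻¹ = Bᵀ * B := by
    apply Matrix.inv_eq_right_inv
    rw [hVA]
    calc A * Aᵀ * (Bᵀ * B) = A * (Aᵀ * Bᵀ) * B := by simp only [Matrix.mul_assoc]
      _ = 1 := by rw [hBAt, Matrix.mul_one, hAB]
  set E := B * (S - V) * Bᵀ with hEdef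
  have hBV : B * V * Bᵀ = 1 := by
    calc B * V * Bᵀ = (B * A) * (Aᵀ * Bᵀ) := by rw [hVA]; simp only [Matrix.mul_assoc]
      _ = 1 := by rw [hBA, hBAt, Matrix.one_mul]
  have h1E : 1 + E = B * S * Bᵀ := by
    rw [hEdef, Matrix.mul_sub, Matrix.sub_mul, hBV]; abel
  have hlogM : Real.log M.det = Real.log V.det + Real.log H.det := by
    rw [← Real.log_mul hV.det_pos.ne' hH.det_pos.ne']
    congr 1
    rw [hMH, hVA]
    simp only [Matrix.det_mul, Matrix.det_transpose]
    ring
  have hobj' : Real.log H.det + ((1 + E) * H⁻¹).trace ≤ (1 + E).trace := by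
    have e1 : (S * M⁻¹).trace = ((1 + E) * H⁻¹).trace := by
      rw [hMinv, h1E, ← Matrix.mul_assoc, Matrix.trace_mul_comm]
      simp only [Matrix.mul_assoc]
    have e2 : (S * V⁻¹).trace = (1 + E).trace := by
      rw [hVinv, h1E, ← Matrix.mul_assoc, Matrix.trace_mul_comm]
      simp only [Matrix.mul_assoc]
    rw [e1, e2, hlogM] at hobj
    linarith
  have hEb : ∀ i j, |E i j| ≤ b * ε := hBb (S - V) ε hε0 fun i j => by simpa using hS i j
  have hsmall : 4 * (Fintype.card n : ℝ) ^ 3 * (b * ε) ≤ 1 / 2 := by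
    have h1 : (8 * c * b + 1) * ε ≤ 1 := by
      rw [le_div_iff₀ (by positivity)] at hε
      linarith
    rw [← hc]
    nlinarith
  have hH1 := abs_sub_one_le_of_objective_le hH (by positivity) hEb hsmall hobj'
  have hMV : M - V = A * (H - 1) * Aᵀ := by
    rw [Matrix.mul_sub, Matrix.sub_mul, Matrix.mul_one, ← hMH, ← hVA]
  have := hAa (H - 1) _ (by positivity) hH1 i j
  rw [← hMV] at this
  refine (by simpa using this : |M i j - V i j| ≤ _).trans ?_
  nlinarith

end Matrices

/-! ### Recovering error variances and loadings from the covariance matrix. -/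

section Identification

open Matrix

attribute [local instance] Matrix.normedAddCommGroup Matrix.normedSpace

theorem differentiable_det {r : ℕ} : Differentiable ℝ (fun M : Matrix (Fin r) (Fin r) ℝ => M.det) := by
  simp only [Matrix.det_apply']
  have : ∀ i j : Fin r, Differentiable ℝ (fun M : Matrix (Fin r) (Fin r) ℝ => M i j) := by
    intro i j
    exact differentiable_pi.mp (differentiable_pi.mp differentiable_id i) j
  fun_prop

theorem differentiable_submatrix {n : Type*} [Fintype n] {r : ℕ} (f g : Fin r → n) :
    Differentiable ℝ (fun M : Matrix n n ℝ => M.submatrix f g) := by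
  refine differentiable_pi.mpr fun i => differentiable_pi.mpr fun j => ?_
  exact differentiable_pi.mp (differentiable_pi.mp differentiable_id (f i)) (g j)

theorem det_mul_transpose_eq_zero {r : ℕ} (X Y : Matrix (Fin (r + 1)) (Fin r) ℝ) :
    (X * Yᵀ).det = 0 := by
  by_contra h
  have h1 : (X * Yᵀ).rank = r + 1 := by
    rw [Matrix.rank_of_isUnit _ ((Matrix.isUnit_iff_isUnit_det _).mpr (isUnit_iff_ne_zero.mpr h))]
    simp
  have h2 := (Matrix.rank_mul_le_left X Yᵀ).trans (Matrix.rank_le_width X)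
  omega

/-- The bordered minor of `L Lᵀ + diag ψ` that meets the diagonal in one place only. -/
theorem det_bordered_minor {n : Type*} [Fintype n] [DecidableEq n] {r : ℕ}
    (L : Matrix n (Fin r) ℝ) (ψ : n → ℝ) (i : n) (f g : Fin r → n)
    (hf : ∀ a, f a ≠ i) (hg : ∀ a, g a ≠ i) (hfg : ∀ a b, f a ≠ g b) :
    ((L * Lᵀ + diagonal ψ).submatrix (Fin.cons i f : Fin (r + 1) → n) (Fin.cons i g)).det =
      ψ i * ((L * Lᵀ + diagonal ψ).submatrix f g).det := by
  set M := L * Lᵀ + diagonal ψ with hM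
  set X := M.submatrix (Fin.cons i f : Fin (r + 1) → n) (Fin.cons i g) with hX
  -- `K` is the common part, of size `r + 1` but rank at most `r`, hence singular. The bordered
  -- matrix `X` differs from it only in the corner entry, by `ψ i`, so expanding both along the
  -- first row leaves `ψ i` times the corner's minor.
  set K := L.submatrix (Fin.cons i f : Fin (r + 1) → n) id *
    (L.submatrix (Fin.cons i g : Fin (r + 1) → n) id)ᵀ with hK
  have hK0 : K.det = 0 := det_mul_transpose_eq_zero _ _
  have h00 : X 0 0 = K 0 0 + ψ i := by simp [hX, hK, hM, Matrix.mul_apply]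
  have h0s : ∀ j : Fin r, X 0 j.succ = K 0 j.succ := by
    intro j
    simp [hX, hK, hM, Matrix.mul_apply, Matrix.diagonal_apply_ne _ (hg j).symm]
  have hs : ∀ (a : Fin r) (j : Fin (r + 1)), X a.succ j = K a.succ j := by
    intro a j
    refine Fin.cases ?_ (fun b => ?_) j
    · simp [hX, hK, hM, Matrix.mul_apply, Matrix.diagonal_apply_ne _ (hf a)]
    · simp [hX, hK, hM, Matrix.mul_apply, Matrix.diagonal_apply_ne _ (hfg a b)]
  have hminor : ∀ j : Fin (r + 1), X.submatrix Fin.succ j.succAbove =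
      K.submatrix Fin.succ j.succAbove := by
    intro j; ext a b; exact hs a _
  have hXs : X.submatrix Fin.succ (Fin.succAbove 0) = M.submatrix f g := by
    ext a b; simp [hX]
  have hdX := Matrix.det_succ_row_zero X
  have hdK := Matrix.det_succ_row_zero K
  rw [Fin.sum_univ_succ] at hdX hdK
  simp only [h00, h0s, hminor] at hdX
  rw [hK0] at hdK
  rw [hdX, ← hXs, hminor]
  simp only [Fin.val_zero, pow_zero, one_mul] at hdK ⊢
  linear_combination -hdK

theorem exists_enumeration {n : Type*} [Fintype n] [DecidableEq n] {r : ℕ}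
    (Λ : Matrix n (Fin r) ℝ) (A : Finset n) (hA : A.card = r)
    (hli : LinearIndependent ℝ (fun j : A => Λ.row j)) :
    ∃ f : Fin r → n, (∀ a, f a ∈ A) ∧ (Λ.submatrix f id).det ≠ 0 := by
  let e : Fin r ≃ A := (finCongr hA.symm).trans A.equivFin.symm
  refine ⟨fun a => e a, fun a => (e a).2, ?_⟩
  have h1 : LinearIndependent ℝ (Λ.submatrix (fun a => (e a : n)) id).row :=
    hli.comp e e.injective
  have := (Matrix.linearIndependent_rows_iff_isUnit).mp h1
  exact ((Matrix.isUnit_iff_isUnit_det _).mp this).ne_zero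

/-- `ψ i` is the bordered minor divided by the minor with rows `f` and columns `g`. The latter
avoids the diagonal and at the true matrix equals a product of two nonzero loading determinants. The
ratio is therefore differentiable there, which yields the linear bound; nonvanishing of the same
minor nearby makes the block `f` of `L` invertible. -/
theorem eventually_abs_unique_variance_sub_le {n : Type*} [Fintype n] [DecidableEq n] {r : ℕ}
    (Λ : Matrix n (Fin r) ℝ) (s : n → ℝ) (i : n) (f g : Fin r → n)
    (hf : ∀ a, f a ≠ i) (hg : ∀ a, g a ≠ i) (hfg : ∀ a b, f a ≠ g b)
    (hΛf : (Λ.submatrix f id).det ≠ 0) (hΛg : (Λ.submatrix g id).det ≠ 0) :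
    ∃ C : ℝ, ∀ᶠ M in 𝓝 (Λ * Λᵀ + diagonal s), ∀ (L : Matrix n (Fin r) ℝ) (ψ : n → ℝ),
      M = L * Lᵀ + diagonal ψ →
      (L.submatrix f id).det ≠ 0 ∧ |ψ i - s i| ≤ C * ‖M - (Λ * Λᵀ + diagonal s)‖ := by
  have hsub : ∀ (L : Matrix n (Fin r) ℝ) (ψ : n → ℝ), (L * Lᵀ + diagonal ψ).submatrix f g =
      L.submatrix f id * (L.submatrix g id)ᵀ := by
    intro L ψ
    ext a b
    simp [Matrix.mul_apply, Matrix.diagonal_apply_ne _ (hfg a b)]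
  set V := Λ * Λᵀ + diagonal s with hV
  have hVd : (V.submatrix f g).det ≠ 0 := by
    rw [hV, hsub, Matrix.det_mul, Matrix.det_transpose]
    exact mul_ne_zero hΛf hΛg
  have hd1 : Differentiable ℝ (fun M : Matrix n n ℝ => (M.submatrix f g).det) :=
    differentiable_det.comp (differentiable_submatrix f g)
  have hd2 : Differentiable ℝ (fun M : Matrix n n ℝ =>
      (M.submatrix (Fin.cons i f : Fin (r + 1) → n) (Fin.cons i g)).det) :=
    differentiable_det.comp (differentiable_submatrix _ _)
  have hG : DifferentiableAt ℝ (fun M : Matrix n n ℝ =>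
      (M.submatrix (Fin.cons i f : Fin (r + 1) → n) (Fin.cons i g)).det /
        (M.submatrix f g).det) V := by
    have := (hd2 V).fun_mul ((hd1 V).fun_inv hVd)
    simp only [div_eq_mul_inv]
    exact this
  obtain ⟨C, hC⟩ := hG.isBigO_sub.bound
  refine ⟨C, ?_⟩
  filter_upwards [hC, hd1.continuous.continuousAt.eventually_ne hVd] with M hM hMd L ψ hL
  have hL' : (L.submatrix f id).det * (L.submatrix g id).det ≠ 0 := by
    rw [hL, hsub, Matrix.det_mul, Matrix.det_transpose] at hMd
    exact hMd
  refine ⟨left_ne_zero_of_mul hL', ?_⟩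
  have e1 : (M.submatrix (Fin.cons i f : Fin (r + 1) → n) (Fin.cons i g)).det /
        (M.submatrix f g).det = ψ i := by
    rw [div_eq_iff hMd, hL]
    exact det_bordered_minor L ψ i f g hf hg hfg
  have e2 : (V.submatrix (Fin.cons i f : Fin (r + 1) → n) (Fin.cons i g)).det /
        (V.submatrix f g).det = s i := by
    rw [div_eq_iff hVd]
    exact det_bordered_minor Λ s i f g hf hg hfg
  rw [e1, e2] at hM
  exact hM

/-- With the variances under control, `L * Lᵀ` is linearly close to `Λ * Λᵀ`. For one invertible
block `A` of rows, `Q = L_Aᵀ * (Λ_Aᵀ)⁻¹` gives `L * Q = (L * L_Aᵀ) * (Λ_Aᵀ)⁻¹`, close to `Λ * Λ_Aᵀ *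
(Λ_Aᵀ)⁻¹ = Λ`. The transformation need not be orthogonal, which suffices for regression on the
loadings. -/
theorem eventually_loadings_near {n : Type*} [Fintype n] [DecidableEq n] {r : ℕ}
    (Λ : Matrix n (Fin r) ℝ) (s : n → ℝ)
    (hAR : ∀ i : n, ∃ A B : Finset n, i ∉ A ∧ i ∉ B ∧ Disjoint A B ∧ A.card = r ∧ B.card = r ∧
      LinearIndependent ℝ (fun j : A => Λ.row j) ∧ LinearIndependent ℝ (fun j : B => Λ.row j)) :
    ∃ C : ℝ, 0 ≤ C ∧ ∀ᶠ M in 𝓝 (Λ * Λᵀ + diagonal s), ∀ (L : Matrix n (Fin r) ℝ) (ψ : n → ℝ),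
      M = L * Lᵀ + diagonal ψ →
      (∀ i, |ψ i - s i| ≤ C * ‖M - (Λ * Λᵀ + diagonal s)‖) ∧
      ∃ Q : Matrix (Fin r) (Fin r) ℝ, IsUnit Q.det ∧
        ∀ i k, |(L * Q) i k - Λ i k| ≤ C * ‖M - (Λ * Λᵀ + diagonal s)‖ := by
  have key : ∀ i : n, ∃ (C : ℝ) (f : Fin r → n), (Λ.submatrix f id).det ≠ 0 ∧
      ∀ᶠ M in 𝓝 (Λ * Λᵀ + diagonal s), ∀ (L : Matrix n (Fin r) ℝ) (ψ : n → ℝ),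
      M = L * Lᵀ + diagonal ψ →
      (L.submatrix f id).det ≠ 0 ∧ |ψ i - s i| ≤ C * ‖M - (Λ * Λᵀ + diagonal s)‖ := by
    intro i
    obtain ⟨A, B, hiA, hiB, hAB, hA, hB, hlA, hlB⟩ := hAR i
    obtain ⟨f, hfA, hf⟩ := exists_enumeration Λ A hA hlA
    obtain ⟨g, hgB, hg⟩ := exists_enumeration Λ B hB hlB
    obtain ⟨C, hC⟩ := eventually_abs_unique_variance_sub_le Λ s i f g
      (fun a h => hiA (h ▸ hfA a)) (fun a h => hiB (h ▸ hgB a))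
      (fun a b h => Finset.disjoint_left.mp hAB (hfA a) (h ▸ hgB b)) hf hg
    exact ⟨C, f, hf, hC⟩
  choose C f hf hC using key
  set C₁ := ∑ i, |C i| with hC₁
  have hC₁0 : 0 ≤ C₁ := Finset.sum_nonneg fun i _ => abs_nonneg _
  have hCi : ∀ i, C i ≤ C₁ := fun i => (le_abs_self _).trans
    (Finset.single_le_sum (f := fun i => |C i|) (fun i _ => abs_nonneg _) (Finset.mem_univ i))
  rcases isEmpty_or_nonempty n with hn | ⟨⟨i₀⟩⟩
  · exact ⟨0, le_rfl, .of_forall fun M L ψ _ =>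
      ⟨fun i => hn.elim i, 1, by simp, fun i => hn.elim i⟩⟩
  set ΛA := Λ.submatrix (f i₀) id with hΛA
  obtain ⟨c, hc0, hc⟩ := exists_abs_entry_mul_mul_le (1 : Matrix n n ℝ) (ΛAᵀ)⁻¹
  refine ⟨C₁ + c * (1 + C₁), by positivity, ?_⟩
  filter_upwards [eventually_all.mpr hC] with M hM L ψ hL
  set V := Λ * Λᵀ + diagonal s with hV
  have hnn : 0 ≤ ‖M - V‖ := norm_nonneg _
  have hψ : ∀ i, |ψ i - s i| ≤ C₁ * ‖M - V‖ := fun i =>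
    ((hM i L ψ hL).2).trans (mul_le_mul_of_nonneg_right (hCi i) hnn)
  have hmono : C₁ * ‖M - V‖ ≤ (C₁ + c * (1 + C₁)) * ‖M - V‖ := by
    gcongr; linarith [mul_nonneg hc0 (by linarith : 0 ≤ 1 + C₁)]
  refine ⟨fun i => (hψ i).trans hmono, ?_⟩
  set LA := L.submatrix (f i₀) id with hLA
  have hLAd : LA.det ≠ 0 := (hM i₀ L ψ hL).1
  refine ⟨LAᵀ * (ΛAᵀ)⁻¹, ?_, ?_⟩
  · rw [Matrix.det_mul, Matrix.det_transpose]
    refine (isUnit_iff_ne_zero.mpr hLAd).mul ?_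
    rw [Matrix.det_nonsing_inv, Matrix.det_transpose]
    exact (isUnit_iff_ne_zero.mpr (hf i₀)).ringInverse
  · intro i k
    have hdiff : L * (LAᵀ * (ΛAᵀ)⁻¹) - Λ = (1 : Matrix n n ℝ) * (L * LAᵀ - Λ * ΛAᵀ) * (ΛAᵀ)⁻¹ := by
      have : ΛAᵀ * (ΛAᵀ)⁻¹ = 1 := Matrix.mul_nonsing_inv _ (by
        rw [Matrix.det_transpose]; exact isUnit_iff_ne_zero.mpr (hf i₀))
      rw [Matrix.one_mul, Matrix.sub_mul, Matrix.mul_assoc, Matrix.mul_assoc, this, Matrix.mul_one]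
    have hX : ∀ a b, |(L * LAᵀ - Λ * ΛAᵀ) a b| ≤ (1 + C₁) * ‖M - V‖ := by
      intro a b
      have e : (L * LAᵀ - Λ * ΛAᵀ) a b =
          (M - V) a (f i₀ b) - diagonal (fun i => ψ i - s i) a (f i₀ b) := by
        rw [hL, hV]
        simp only [Matrix.sub_apply, Matrix.add_apply, Matrix.mul_apply, Matrix.diagonal_apply,
          Matrix.transpose_apply, hLA, hΛA, Matrix.submatrix_apply, id]
        split_ifs <;> ring
      rw [e]
      have h1 : |(M - V) a (f i₀ b)| ≤ ‖M - V‖ := Matrix.norm_entry_le_entrywise_sup_norm (M - V)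
      have h2 : |diagonal (fun i => ψ i - s i) a (f i₀ b)| ≤ C₁ * ‖M - V‖ := by
        rw [Matrix.diagonal_apply]
        split_ifs
        · exact hψ a
        · simpa using by positivity
      rw [abs_le] at h1 h2 ⊢
      constructor <;> linarith
    have h3 := hc _ _ (by positivity) hX i k
    rw [← hdiff, Matrix.sub_apply] at h3
    refine h3.trans ?_
    rw [← mul_assoc]
    gcongr
    linarith

end Identification

/-! ### Existence and stability of maximum likelihood solutions. -/

section MaximumLikelihood

open Matrix

theorem posDef_mul_transpose_add_diagonal {n m : Type*} [Fintype n] [DecidableEq n] [Fintype m]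
    (L : Matrix n m ℝ) {ψ : n → ℝ} (hψ : ∀ i, 0 < ψ i) : (L * Lᵀ + diagonal ψ).PosDef := by
  have h1 : (L * Lᵀ).PosSemidef := by
    simpa [Matrix.conjTranspose_eq_transpose_of_trivial] using
      Matrix.posSemidef_self_mul_conjTranspose L
  exact Matrix.PosDef.posSemidef_add h1 (Matrix.PosDef.diagonal hψ)

theorem exists_pos_le {ι : Type*} [Finite ι] (s : ι → ℝ) (hs : ∀ i, 0 < s i) :
    ∃ m : ℝ, 0 < m ∧ ∀ i, m ≤ s i := by
  rcases isEmpty_or_nonempty ι with h | h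
  · exact ⟨1, one_pos, fun i => h.elim i⟩
  · obtain ⟨i, hi⟩ := Finite.exists_min s
    exact ⟨s i, hs i, hi⟩

theorem continuousAt_inv_of_det_ne_zero {n : Type*} [Fintype n] [DecidableEq n] {M : Matrix n n ℝ}
    (hM : M.det ≠ 0) : ContinuousAt (fun X : Matrix n n ℝ => X⁻¹) M := by
  simp only [Matrix.inv_def, Ring.inverse_eq_inv']
  exact ((Continuous.matrix_det continuous_id).continuousAt.inv₀ hM).smul
    (Continuous.matrix_adjugate continuous_id).continuousAt

theorem continuousAt_factorObjective {N r : ℕ} (S : Matrix (Fin N) (Fin N) ℝ)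
    (p : Matrix (Fin N) (Fin r) ℝ × (Fin N → ℝ)) (hp : ∀ i, 0 < p.2 i) :
    ContinuousAt (fun p : Matrix (Fin N) (Fin r) ℝ × (Fin N → ℝ) => factorObjective S p.1 p.2) p := by
  have hM : Continuous (fun p : Matrix (Fin N) (Fin r) ℝ × (Fin N → ℝ) =>
      p.1 * p.1ᵀ + diagonal p.2) := by
    fun_prop
  have hdet : (p.1 * p.1ᵀ + diagonal p.2).det ≠ 0 :=
    (posDef_mul_transpose_add_diagonal p.1 hp).det_pos.ne'
  unfold factorObjective
  refine (hM.matrix_det.continuousAt.log hdet).add ?_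
  have h1 : ContinuousAt (fun p : Matrix (Fin N) (Fin r) ℝ × (Fin N → ℝ) =>
      (p.1 * p.1ᵀ + diagonal p.2)⁻¹) p :=
    ContinuousAt.comp (f := fun p : Matrix (Fin N) (Fin r) ℝ × (Fin N → ℝ) =>
      p.1 * p.1ᵀ + diagonal p.2) (continuousAt_inv_of_det_ne_zero hdet) hM.continuousAt
  have h2 : Continuous (fun X : Matrix (Fin N) (Fin N) ℝ => (S * X).trace) := by fun_prop
  exact h2.continuousAt.comp h1

/-- A minimizer of the likelihood objective can be rotated to one that satisfies the
normalization. -/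
theorem exists_isFactorMLE_of_isMin {N r : ℕ} (S : Matrix (Fin N) (Fin N) ℝ)
    (L : Matrix (Fin N) (Fin r) ℝ) (ψ : Fin N → ℝ) (hψ : ∀ i, 0 < ψ i)
    (hmin : ∀ (L' : Matrix (Fin N) (Fin r) ℝ) (ψ' : Fin N → ℝ), (∀ i, 0 < ψ' i) →
      factorObjective S L ψ ≤ factorObjective S L' ψ') :
    ∃ (L : Matrix (Fin N) (Fin r) ℝ) (ψ : Fin N → ℝ), IsFactorMLE S L ψ := by
  have hW : (Lᵀ * (diagonal ψ)⁻¹ * L).IsHermitian := by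
    rw [Matrix.IsHermitian, Matrix.conjTranspose_eq_transpose_of_trivial]
    rw [Matrix.transpose_mul, Matrix.transpose_mul, Matrix.transpose_nonsing_inv,
      Matrix.diagonal_transpose, Matrix.transpose_transpose, Matrix.mul_assoc]
  obtain ⟨U, hU1, hU2, hUH⟩ := exists_orthogonal_diagonalization hW
  refine ⟨L * U, ψ, hψ, ?_, ?_⟩
  · have : (L * U)ᵀ * (diagonal ψ)⁻¹ * (L * U) = Uᵀ * (Lᵀ * (diagonal ψ)⁻¹ * L) * U := by
      rw [Matrix.transpose_mul]
      simp only [Matrix.mul_assoc]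
    rw [this, hUH]
    have : Uᵀ * (U * diagonal hW.eigenvalues * Uᵀ) * U =
        (Uᵀ * U) * diagonal hW.eigenvalues * (Uᵀ * U) := by
      simp only [Matrix.mul_assoc]
    rw [this, hU1, Matrix.one_mul, Matrix.mul_one]
    exact Matrix.isDiag_diagonal _
  · have : (L * U) * (L * U)ᵀ = L * Lᵀ := by
      rw [Matrix.transpose_mul, Matrix.mul_assoc, ← Matrix.mul_assoc U, hU2, Matrix.one_mul]
    intro L' ψ' h'
    have h2 := hmin L' ψ' h'
    unfold factorObjective at h2 ⊢
    rwa [this]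

section

attribute [local instance] Matrix.normedAddCommGroup Matrix.normedSpace

/-- Only an objective value no larger than at the truth is required. The bound thus covers the
estimator itself and also confines the whole sublevel set, from which existence of a minimizer is
deduced. -/
theorem exists_sublevel_bound {N r : ℕ} (Λ : Matrix (Fin N) (Fin r) ℝ) (s : Fin N → ℝ)
    (hs : ∀ i, 0 < s i)
    (hAR : ∀ i : Fin N, ∃ A B : Finset (Fin N), i ∉ A ∧ i ∉ B ∧ Disjoint A B ∧
      A.card = r ∧ B.card = r ∧
      LinearIndependent ℝ (fun j : A => Λ.row j) ∧ LinearIndependent ℝ (fun j : B => Λ.row j)) :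
    ∃ C ε₀ : ℝ, 0 < C ∧ 0 < ε₀ ∧ ∀ (S : Matrix (Fin N) (Fin N) ℝ) (ε : ℝ), 0 ≤ ε → ε ≤ ε₀ →
      (∀ i j, |S i j - (Λ * Λᵀ + diagonal s) i j| ≤ ε) →
      ∀ (L : Matrix (Fin N) (Fin r) ℝ) (ψ : Fin N → ℝ), (∀ i, 0 < ψ i) →
        factorObjective S L ψ ≤ factorObjective S Λ s →
        (∀ i j, |(L * Lᵀ + diagonal ψ) i j - (Λ * Λᵀ + diagonal s) i j| ≤ C * ε) ∧
        (∀ i, |ψ i - s i| ≤ C * ε) ∧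
        ∃ Q : Matrix (Fin r) (Fin r) ℝ, IsUnit Q.det ∧ ∀ i k, |(L * Q) i k - Λ i k| ≤ C * ε := by
  obtain ⟨C₁, ε₁, hC₁, hε₁, h₁⟩ :=
    exists_bound_of_objective_le (posDef_mul_transpose_add_diagonal Λ hs)
  obtain ⟨C₂, hC₂, h₂⟩ := eventually_loadings_near Λ s hAR
  obtain ⟨δ, hδ, hball⟩ := Metric.eventually_nhds_iff.mp h₂
  refine ⟨C₁ + C₂ * C₁, min ε₁ (δ / (2 * C₁)), by positivity, by positivity, ?_⟩
  intro S ε hε0 hε hS L ψ hψ hobj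
  have hM := h₁ (L * Lᵀ + diagonal ψ) S ε (posDef_mul_transpose_add_diagonal L hψ) hε0
    (hε.trans (min_le_left _ _)) hS hobj
  set V := Λ * Λᵀ + diagonal s
  have hnorm : ‖L * Lᵀ + diagonal ψ - V‖ ≤ C₁ * ε :=
    (Matrix.norm_le_iff (by positivity)).mpr fun i j => by
      simpa [Real.norm_eq_abs] using hM i j
  have hεδ : C₁ * ε < δ := by
    have := hε.trans (min_le_right _ _)
    rw [le_div_iff₀ (by positivity)] at this
    nlinarith
  obtain ⟨hψs, Q, hQ, hLQ⟩ := hball (y := L * Lᵀ + diagonal ψ)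
    (by rw [dist_eq_norm]; exact hnorm.trans_lt hεδ) L ψ rfl
  have hle : C₂ * ‖L * Lᵀ + diagonal ψ - V‖ ≤ (C₁ + C₂ * C₁) * ε := by
    have := mul_le_mul_of_nonneg_left hnorm hC₂
    nlinarith [mul_nonneg hC₁.le hε0]
  refine ⟨fun i j => (hM i j).trans ?_, fun i => (hψs i).trans hle, Q, hQ,
    fun i k => (hLQ i k).trans hle⟩
  nlinarith [mul_nonneg (mul_nonneg hC₂ hC₁.le) hε0]

end

/-- Near the true covariance matrix, maximum likelihood solutions exist, and their loadings agree
up to an invertible transformation with the true ones, with a linear error bound. -/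
theorem exists_mle_bound {N r : ℕ} (Λ : Matrix (Fin N) (Fin r) ℝ) (s : Fin N → ℝ)
    (hs : ∀ i, 0 < s i)
    (hAR : ∀ i : Fin N, ∃ A B : Finset (Fin N), i ∉ A ∧ i ∉ B ∧ Disjoint A B ∧
      A.card = r ∧ B.card = r ∧
      LinearIndependent ℝ (fun j : A => Λ.row j) ∧ LinearIndependent ℝ (fun j : B => Λ.row j)) :
    ∃ C ε₀ : ℝ, 0 < C ∧ 0 < ε₀ ∧ ∀ (S : Matrix (Fin N) (Fin N) ℝ) (ε : ℝ), 0 ≤ ε → ε ≤ ε₀ →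
      (∀ i j, |S i j - (Λ * Λᵀ + diagonal s) i j| ≤ ε) →
      (∃ (L : Matrix (Fin N) (Fin r) ℝ) (ψ : Fin N → ℝ), IsFactorMLE S L ψ) ∧
      ∀ (L : Matrix (Fin N) (Fin r) ℝ) (ψ : Fin N → ℝ), IsFactorMLE S L ψ →
        ∃ Q : Matrix (Fin r) (Fin r) ℝ, IsUnit Q.det ∧ ∀ i k, |(L * Q) i k - Λ i k| ≤ C * ε := by
  obtain ⟨C, ε₁, hC, hε₁, h⟩ := exists_sublevel_bound Λ s hs hAR
  obtain ⟨m, hm, hms⟩ := exists_pos_le s hs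
  -- The bound `m / 2` keeps every `ψ i` between `s i / 2` and `2 * s i`; the bound 1 on the
  -- diagonal of the implied covariance matrix keeps the loadings bounded.
  refine ⟨C, min ε₁ (min (m / 2) 1 / C), hC, by positivity, ?_⟩
  intro S ε hε0 hε hS
  have hsub := h S ε hε0 (hε.trans (min_le_left _ _)) hS
  refine ⟨?_, fun L ψ hL => (hsub L ψ hL.1 (hL.2.2 Λ s hs)).2.2⟩
  have hCε : C * ε ≤ min (m / 2) 1 := by
    have := hε.trans (min_le_right _ _)
    rw [le_div_iff₀ hC] at this
    linarith
  have hCm : C * ε ≤ m / 2 := hCε.trans (min_le_left _ _)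
  have hC1 : C * ε ≤ 1 := hCε.trans (min_le_right _ _)
  set V := Λ * Λᵀ + diagonal s with hV
  have hVpos := posDef_mul_transpose_add_diagonal Λ hs
  set R := 2 + ∑ i, V i i with hR
  have hVR : ∀ i, V i i + 2 ≤ R := by
    intro i
    have := Finset.single_le_sum (f := fun i => V i i) (fun j _ => hVpos.diag_pos.le)
      (Finset.mem_univ i)
    linarith
  -- A compact box containing the sublevel set of the truth. Its variances stay away from zero, so
  -- the objective is continuous on it and attains a minimum; competitors outside the sublevel set
  -- already lose to the truth.
  let K : Set (Matrix (Fin N) (Fin r) ℝ × (Fin N → ℝ)) :=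
    (Set.Icc (fun _ _ => -R : Fin N → Fin r → ℝ) (fun _ _ => R)) ×ˢ
      Set.Icc (fun i => s i / 2) (fun i => 2 * s i)
  have hK : IsCompact K :=
    (isCompact_Icc (α := Fin N → Fin r → ℝ)).prod (isCompact_Icc (α := Fin N → ℝ))
  have hmem : ∀ (L : Matrix (Fin N) (Fin r) ℝ) (ψ : Fin N → ℝ), (∀ i, 0 < ψ i) →
      factorObjective S L ψ ≤ factorObjective S Λ s → (L, ψ) ∈ K := by
    intro L ψ hψ hobj
    obtain ⟨hM, hψs, -⟩ := hsub L ψ hψ hobj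
    have hL : ∀ i k, |L i k| ≤ R := by
      intro i k
      have h1 : (L * Lᵀ + diagonal ψ) i i = ∑ l, L i l * L i l + ψ i := by
        simp [Matrix.mul_apply]
      have h2 : L i k * L i k ≤ ∑ l, L i l * L i l :=
        Finset.single_le_sum (f := fun l => L i l * L i l) (fun l _ => mul_self_nonneg _)
          (Finset.mem_univ k)
      have h3 := (abs_le.mp ((hM i i).trans hC1)).2
      rw [h1] at h3
      have h4 := hψ i
      have h5 := hVR i
      have h6 : |L i k| * |L i k| = L i k * L i k := abs_mul_abs_self _
      nlinarith [sq_nonneg (|L i k| - 1)]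
    refine ⟨⟨fun i k => (abs_le.mp (hL i k)).1, fun i k => (abs_le.mp (hL i k)).2⟩,
      fun i => ?_, fun i => ?_⟩
    · have := (abs_le.mp ((hψs i).trans hCm)).1
      have := hms i
      simp only
      linarith
    · have := (abs_le.mp ((hψs i).trans hCm)).2
      have := hms i
      simp only
      linarith
  have hKpos : ∀ p ∈ K, ∀ i, 0 < p.2 i := fun p hp i =>
    (half_pos (hs i)).trans_le (hp.2.1 i)
  obtain ⟨p, hpK, hp⟩ := hK.exists_isMinOn ⟨_, hmem Λ s hs le_rfl⟩
    (f := fun p : Matrix (Fin N) (Fin r) ℝ × (Fin N → ℝ) => factorObjective S p.1 p.2)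
    fun p hp => (continuousAt_factorObjective S p (hKpos p hp)).continuousWithinAt
  refine exists_isFactorMLE_of_isMin S p.1 p.2 (hKpos p hpK) fun L' ψ' h' => ?_
  have hpΛ : factorObjective S p.1 p.2 ≤ factorObjective S Λ s := hp (hmem Λ s hs le_rfl)
  by_cases hle : factorObjective S L' ψ' ≤ factorObjective S Λ s
  · exact hp (hmem L' ψ' h' hle)
  · exact hpΛ.trans (not_le.mp hle).le

end MaximumLikelihood

/-! ### Least trimmed squares with estimated regressors. -/

section TrimmedRegression

open Matrix

/-- If the residual in sorted position `j` exceeded `b`, all members of `T` would sit in positions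
before `j`, and there are only `j < T.card` of these. -/
theorem sort_apply_le {N : ℕ} (res : Fin N → ℝ) (T : Finset (Fin N)) {b : ℝ}
    (hT : ∀ i ∈ T, res i ≤ b) (j : Fin N) (hj : j.val < T.card) : res (Tuple.sort res j) ≤ b := by
  by_contra hcon
  rw [not_le] at hcon
  have hsub : T.map (Tuple.sort res).symm.toEmbedding ⊆ Finset.Iio j := by
    intro i hi
    simp only [Finset.mem_map, Equiv.coe_toEmbedding] at hi
    obtain ⟨k, hk, rfl⟩ := hi
    rw [Finset.mem_Iio]
    by_contra hlt
    have := Tuple.monotone_sort res (not_lt.mp hlt)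
    simp only [Function.comp_apply, Equiv.apply_symm_apply] at this
    linarith [hT k hk]
  have := Finset.card_le_card hsub
  rw [Finset.card_map, Fin.card_Iio] at this
  omega

theorem ltsObjective_le {N r : ℕ} (L : Matrix (Fin N) (Fin r) ℝ) (y : Fin N → ℝ) (a : Fin r → ℝ)
    (T : Finset (Fin N)) (hT : N / 2 + 1 ≤ T.card) {b : ℝ}
    (hb : ∀ i ∈ T, |y i - L.row i ⬝ᵥ a| ≤ b) : ltsObjective L y a ≤ (N / 2 + 1 : ℕ) * b ^ 2 := by
  have hcard : (Finset.univ.filter fun i : Fin N => i.val < N / 2 + 1).card ≤ N / 2 + 1 := by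
    rw [Fin.card_filter_val_lt]
    exact min_le_right _ _
  calc ltsObjective L y a ≤ ∑ i : Fin N with i.val < N / 2 + 1, b ^ 2 := by
        refine Finset.sum_le_sum fun i hi => ?_
        refine sort_apply_le (fun i => (y i - L.row i ⬝ᵥ a) ^ 2) T (fun k hk => ?_) i
          ((Finset.mem_filter.mp hi).2.trans_le hT)
        exact sq_le_sq' (abs_le.mp (hb k hk)).1 (abs_le.mp (hb k hk)).2
    _ = (Finset.univ.filter fun i : Fin N => i.val < N / 2 + 1).card * b ^ 2 := by
        rw [Finset.sum_const, nsmul_eq_mul]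
    _ ≤ _ := by gcongr

theorem exists_card_of_ltsObjective_le {N r : ℕ} (hN : N / 2 + 1 ≤ N)
    (L : Matrix (Fin N) (Fin r) ℝ) (y : Fin N → ℝ) (a : Fin r → ℝ) {b : ℝ} (hb0 : 0 ≤ b)
    (hb : ltsObjective L y a ≤ b ^ 2) :
    ∃ H : Finset (Fin N), H.card = N / 2 + 1 ∧ ∀ i ∈ H, |y i - L.row i ⬝ᵥ a| ≤ b := by
  set res : Fin N → ℝ := fun i => (y i - L.row i ⬝ᵥ a) ^ 2 with hres
  refine ⟨(Finset.univ.filter fun i : Fin N => i.val < N / 2 + 1).map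
    (Tuple.sort res).toEmbedding, ?_, ?_⟩
  · rw [Finset.card_map, Fin.card_filter_val_lt]
    exact min_eq_right hN
  · intro i hi
    obtain ⟨k, hk, rfl⟩ := Finset.mem_map.mp hi
    have h1 : res (Tuple.sort res k) ≤ ltsObjective L y a :=
      Finset.single_le_sum (f := fun k => res (Tuple.sort res k)) (fun j _ => sq_nonneg _) hk
    exact abs_le_of_sq_le_sq (h1.trans hb) hb0

/-- For each `w` in the span, `w ⬝ᵥ x` is a fixed linear combination of the bounded numbers `v i ⬝ᵥ
x`; the coordinate vectors are such `w`. -/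
theorem exists_bound_of_span_eq_top {ι : Type*} {r : ℕ} (v : ι → Fin r → ℝ) (S : Set ι)
    (hS : Submodule.span ℝ (v '' S) = ⊤) :
    ∃ K : ℝ, 0 ≤ K ∧ ∀ (x : Fin r → ℝ) (b : ℝ), (∀ i ∈ S, |v i ⬝ᵥ x| ≤ b) →
      0 ≤ b → ∑ k, |x k| ≤ K * b := by
  have key : ∀ w : Fin r → ℝ, ∃ K : ℝ, 0 ≤ K ∧ ∀ (x : Fin r → ℝ) (b : ℝ),
      (∀ i ∈ S, |v i ⬝ᵥ x| ≤ b) → 0 ≤ b → |w ⬝ᵥ x| ≤ K * b := by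
    intro w
    have hw : w ∈ Submodule.span ℝ (v '' S) := hS ▸ Submodule.mem_top
    induction hw using Submodule.span_induction with
    | mem w hw =>
      obtain ⟨i, hi, rfl⟩ := hw
      exact ⟨1, zero_le_one, fun x b h _ => by simpa using h i hi⟩
    | zero => exact ⟨0, le_rfl, fun x b _ _ => by simp⟩
    | add w₁ w₂ _ _ h₁ h₂ =>
      obtain ⟨K₁, hK₁, h₁⟩ := h₁
      obtain ⟨K₂, hK₂, h₂⟩ := h₂
      refine ⟨K₁ + K₂, by positivity, fun x b h hb => ?_⟩
      rw [add_dotProduct, add_mul]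
      exact (abs_add_le _ _).trans (add_le_add (h₁ x b h hb) (h₂ x b h hb))
    | smul c w _ h =>
      obtain ⟨K, hK, h⟩ := h
      refine ⟨|c| * K, by positivity, fun x b hx hb => ?_⟩
      rw [smul_dotProduct, smul_eq_mul, abs_mul, mul_assoc]
      exact mul_le_mul_of_nonneg_left (h x b hx hb) (abs_nonneg _)
  choose K hK0 hK using key
  refine ⟨∑ k, K (Pi.single k 1), Finset.sum_nonneg fun k _ => hK0 _, fun x b hx hb => ?_⟩
  rw [Finset.sum_mul]
  refine Finset.sum_le_sum fun k _ => ?_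
  simpa using hK (Pi.single k 1) x b hx hb

theorem abs_dotProduct_le {r : ℕ} (u x : Fin r → ℝ) {e : ℝ} (hu : ∀ k, |u k| ≤ e) :
    |u ⬝ᵥ x| ≤ e * ∑ k, |x k| := by
  rw [dotProduct, Finset.mul_sum]
  refine (Finset.abs_sum_le_sum_abs _ _).trans (Finset.sum_le_sum fun k _ => ?_)
  rw [abs_mul]
  exact mul_le_mul_of_nonneg_right (hu k) (abs_nonneg _)

/-- Least trimmed squares with estimated regressors: the error of the fitted effects is of the
order of the errors in the response and in the regressors. -/
theorem exists_lts_bound {N r : ℕ} (Λ : Matrix (Fin N) (Fin r) ℝ) (K : ℝ) :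
    ∃ C ε₀ : ℝ, 0 < C ∧ 0 < ε₀ ∧ ∀ (L : Matrix (Fin N) (Fin r) ℝ) (Q : Matrix (Fin r) (Fin r) ℝ)
      (y β : Fin N → ℝ) (a α : Fin r → ℝ) (ε : ℝ) (T : Finset (Fin N)),
      IsUnit Q.det → 0 ≤ ε → ε ≤ ε₀ → (∀ k, |α k| ≤ K) → (∀ i ∈ T, β i = 0) →
      N / 2 + 1 ≤ T.card →
      (∀ S ⊆ T, T.card + N / 2 + 1 ≤ N + S.card →
        Submodule.span ℝ (Λ.row '' (S : Set (Fin N))) = ⊤) →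
      (∀ i k, |(L * Q) i k - Λ i k| ≤ ε) → (∀ i, |y i - (β + Λ.mulVec α) i| ≤ ε) →
      IsLTS L y a → ∀ i, |betaHat L y a i - β i| ≤ C * ε := by
  have hspan : ∀ S : Finset (Fin N), ∃ κ : ℝ, 0 ≤ κ ∧
      (Submodule.span ℝ (Λ.row '' (S : Set (Fin N))) = ⊤ →
        ∀ (x : Fin r → ℝ) (b : ℝ), (∀ i ∈ S, |Λ.row i ⬝ᵥ x| ≤ b) → 0 ≤ b →
          ∑ k, |x k| ≤ κ * b) := by
    intro S
    by_cases hS : Submodule.span ℝ (Λ.row '' (S : Set (Fin N))) = ⊤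
    · obtain ⟨κ, hκ, h⟩ := exists_bound_of_span_eq_top Λ.row (S : Set (Fin N)) hS
      exact ⟨κ, hκ, fun _ => h⟩
    · exact ⟨0, le_rfl, fun h => absurd h hS⟩
  choose κ hκ0 hκ using hspan
  -- Summing over all subsets of units, with zero for those that do not span, gives one constant for
  -- every possible control set, so the bound does not depend on the horizon.
  set κ₁ := ∑ S, κ S with hκ₁
  have hκ₁0 : 0 ≤ κ₁ := Finset.sum_nonneg fun S _ => hκ0 S
  have hκle : ∀ S, κ S ≤ κ₁ := fun S =>
    Finset.single_le_sum (fun S _ => hκ0 S) (Finset.mem_univ S)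
  set l := ∑ i, ∑ k, |Λ i k| with hl
  have hl0 : 0 ≤ l := Finset.sum_nonneg fun i _ => Finset.sum_nonneg fun k _ => abs_nonneg _
  have hΛl : ∀ i k, |Λ i k| ≤ l := fun i k =>
    (Finset.single_le_sum (f := fun k => |Λ i k|) (fun k _ => abs_nonneg _)
      (Finset.mem_univ k)).trans
    (Finset.single_le_sum (f := fun i => ∑ k, |Λ i k|)
      (fun i _ => Finset.sum_nonneg fun k _ => abs_nonneg _) (Finset.mem_univ i))
  -- `B * ε` bounds the residual of a control at the true coefficient: `ε` from the response and `ε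
  -- * r * |K|` from the loadings. `D * ε` will bound the coefficient error, its factor 2 coming
  -- from absorbing half of that error.
  set B : ℝ := 1 + r * |K| with hB
  have hB1 : 1 ≤ B := by simp only [hB]; nlinarith [abs_nonneg K, (Nat.cast_nonneg r : (0:ℝ) ≤ r)]
  set D : ℝ := 2 * κ₁ * ((N + 2) * B) with hD
  have hD0 : 0 ≤ D := by positivity
  clear_value κ₁ l
  refine ⟨B + l * D + D, 1 / (2 * κ₁ + 1), by positivity, by positivity, ?_⟩
  intro L Q y β a α ε T hQ hε0 hε hα hβ hT hgp hLQ hy hLTS i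
  have hε' : (2 * κ₁ + 1) * ε ≤ 1 := by
    rw [le_div_iff₀ (by positivity)] at hε
    linarith
  have hε1 : ε ≤ 1 := by nlinarith
  have hκε : κ₁ * ε ≤ 1 / 2 := by nlinarith
  have hN : N / 2 + 1 ≤ N := hT.trans ((Finset.card_le_univ T).trans_eq (Fintype.card_fin N))
  -- The fitted coefficient in the coordinates of `L * Q`, where it is comparable with `α`; the
  -- fitted values do not change.
  set x : Fin r → ℝ := Q⁻¹.mulVec a with hx
  have hLa : ∀ i, L.row i ⬝ᵥ a = (L * Q).row i ⬝ᵥ x := by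
    intro i
    have : L.mulVec a = (L * Q).mulVec x := by
      rw [hx, Matrix.mulVec_mulVec, Matrix.mul_assoc, Matrix.mul_nonsing_inv _ hQ, Matrix.mul_one]
    exact congrFun this i
  have hLQα : ∀ i, L.row i ⬝ᵥ Q.mulVec α = (L * Q).row i ⬝ᵥ α := by
    intro i
    have : L.mulVec (Q.mulVec α) = (L * Q).mulVec α := Matrix.mulVec_mulVec _ _ _
    exact congrFun this i
  have hE : ∀ i z, |(L * Q).row i ⬝ᵥ z - Λ.row i ⬝ᵥ z| ≤ ε * ∑ k, |z k| := by
    intro i z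
    rw [← sub_dotProduct]
    exact abs_dotProduct_le _ _ fun k => hLQ i k
  have hαsum : ∑ k, |α k| ≤ r * |K| := by
    calc ∑ k, |α k| ≤ ∑ _k : Fin r, |K| :=
          Finset.sum_le_sum fun k _ => (hα k).trans (le_abs_self K)
      _ = r * |K| := by simp
  have hyi : ∀ i, |y i - (β i + Λ.row i ⬝ᵥ α)| ≤ ε := hy
  have hres : ∀ i ∈ T, |y i - L.row i ⬝ᵥ Q.mulVec α| ≤ B * ε := by
    intro i hi
    have h1 := hyi i
    have h2 := hE i α
    have h3 : ε * ∑ k, |α k| ≤ ε * (r * |K|) := mul_le_mul_of_nonneg_left hαsum hε0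
    rw [hβ i hi] at h1
    have h4 : B * ε = ε + ε * (r * |K|) := by rw [hB]; ring
    rw [hLQα, h4]
    rw [abs_le] at h1 h2 ⊢
    constructor <;> linarith
  have hobj : ltsObjective L y a ≤ ((N + 1) * (B * ε)) ^ 2 := by
    have h1 := (hLTS (Q.mulVec α)).trans (ltsObjective_le L y _ T hT hres)
    have h2 : ((N / 2 + 1 : ℕ) : ℝ) ≤ (N + 1) ^ 2 := by
      have : ((N / 2 + 1 : ℕ) : ℝ) ≤ N + 1 := by exact_mod_cast (by omega : N / 2 + 1 ≤ N + 1)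
      nlinarith [(Nat.cast_nonneg N : (0:ℝ) ≤ N)]
    rw [mul_pow]
    exact h1.trans (mul_le_mul_of_nonneg_right h2 (sq_nonneg _))
  obtain ⟨H, hHcard, hH⟩ := exists_card_of_ltsObjective_le hN L y a (by positivity) hobj
  -- Inclusion–exclusion in a set of `N` units: enough well-fitted units are controls for general
  -- position to apply.
  have hcardS : T.card + N / 2 + 1 ≤ N + (H ∩ T).card := by
    have h1 := Finset.card_union_add_card_inter H T
    have h2 := (Finset.card_le_univ (H ∪ T)).trans_eq (Fintype.card_fin N)
    omega
  have hs := hgp (H ∩ T) Finset.inter_subset_right hcardS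
  set δ := ∑ k, |(x - α) k| with hδ
  have hδ0 : 0 ≤ δ := Finset.sum_nonneg fun k _ => abs_nonneg _
  have hxsum : ∑ k, |x k| ≤ δ + r * |K| := by
    calc ∑ k, |x k| ≤ ∑ k, (|(x - α) k| + |α k|) := Finset.sum_le_sum fun k _ => by
          have := abs_add_le ((x - α) k) (α k)
          simpa using this
      _ = δ + ∑ k, |α k| := by rw [Finset.sum_add_distrib]
      _ ≤ _ := by linarith
  have hEx : ∀ i, |(L * Q).row i ⬝ᵥ x - Λ.row i ⬝ᵥ x| ≤ ε * (δ + r * |K|) := fun i =>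
    (hE i x).trans (mul_le_mul_of_nonneg_left hxsum hε0)
  -- The loading error multiplies `x`, whose size involves `δ` again. The resulting `κ₁ * ε * δ` is
  -- at most `δ / 2` and is absorbed on the left.
  have hδle : δ ≤ κ₁ * ((N + 2) * B * ε + ε * δ) := by
    refine (hκ (H ∩ T) hs (x - α) ((N + 2) * B * ε + ε * δ) ?_ (by positivity)).trans
      (mul_le_mul_of_nonneg_right (hκle _) (by positivity))
    intro j hj
    have h1 := hH j (Finset.mem_inter.mp hj).1
    have h2 := hyi j
    have h3 := hEx j
    rw [hβ j (Finset.mem_inter.mp hj).2] at h2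
    rw [hLa] at h1
    rw [dotProduct_sub]
    rw [abs_le] at h1 h2 h3 ⊢
    have h4 : ε * (δ + r * |K|) + ε = ε * δ + B * ε := by rw [hB]; ring
    constructor <;> linarith
  have hδD : δ ≤ D * ε := by
    have : κ₁ * ε * δ ≤ 1 / 2 * δ := mul_le_mul_of_nonneg_right hκε hδ0
    rw [hD]
    linarith
  have h1 := hyi i
  have h3 := hEx i
  have h4 := abs_dotProduct_le (Λ.row i) (x - α) (hΛl i)
  rw [← hδ, dotProduct_sub] at h4
  have h5 : l * δ ≤ l * (D * ε) := mul_le_mul_of_nonneg_left hδD hl0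
  have h6 : ε * δ ≤ D * ε := (mul_le_of_le_one_left hδ0 hε1).trans hδD
  have e : betaHat L y a i = y i - (L * Q).row i ⬝ᵥ x := by
    rw [← hLa]; rfl
  have h7 : ε * (δ + r * |K|) + ε = ε * δ + B * ε := by rw [hB]; ring
  rw [e]
  rw [abs_le] at h1 h3 h4 ⊢
  constructor <;> linarith

end TrimmedRegression

/-! ### Bounds on the noise level used in the threshold. -/

section NoiseLevel

open Matrix

/-- An eigenvalue of `S` is a diagonal entry of `Uᵀ * S * U` with `U` orthogonal. There `Λ * Λᵀ`
contributes a nonnegative amount, `diagonal s` at least `m`, and the perturbation at most `N ^ 2 *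
ε₀ ≤ m / 2`. -/
theorem exists_eigenvalue_bounds {N r : ℕ} (Λ : Matrix (Fin N) (Fin r) ℝ) (s : Fin N → ℝ)
    (hs : ∀ i, 0 < s i) :
    ∃ a b ε₀ : ℝ, 0 < a ∧ 0 < b ∧ 0 < ε₀ ∧ ∀ (S : Matrix (Fin N) (Fin N) ℝ) (hS : S.IsHermitian),
      (∀ i j, |S i j - (Λ * Λᵀ + diagonal s) i j| ≤ ε₀) →
      ∀ j, a ≤ hS.eigenvalues₀ j ∧ hS.eigenvalues₀ j ≤ b := by
  obtain ⟨m, hm, hms⟩ := exists_pos_le s hs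
  set V := Λ * Λᵀ + diagonal s with hV
  obtain ⟨c, hc⟩ := (Set.finite_range (fun p : Fin N × Fin N => |V p.1 p.2|)).bddAbove
  have hVc : ∀ i j, |V i j| ≤ max c 0 := fun i j => (hc ⟨(i, j), rfl⟩).trans (le_max_left _ _)
  set ε₀ := m / (2 * ((N : ℝ) ^ 2 + 1)) with hε₀
  have hε0 : 0 < ε₀ := by positivity
  have hε1 : (N : ℝ) ^ 2 * ε₀ ≤ m / 2 := by
    rw [hε₀, mul_div_assoc', div_le_div_iff₀ (by positivity) (by positivity)]
    nlinarith
  refine ⟨m / 2, (N : ℝ) ^ 2 * max c 0 + m, ε₀, by positivity, by positivity, hε0, ?_⟩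
  intro S hS hSV
  have key : ∀ k, m / 2 ≤ hS.eigenvalues k ∧ hS.eigenvalues k ≤ (N : ℝ) ^ 2 * max c 0 + m := by
    intro k
    obtain ⟨U, hU1, hU2, hUH⟩ := exists_orthogonal_diagonalization hS
    have hUe := abs_entry_le_one_of_orthogonal hU2
    have hdiag : Uᵀ * S * U = diagonal hS.eigenvalues := by
      calc Uᵀ * S * U = (Uᵀ * U) * diagonal hS.eigenvalues * (Uᵀ * U) := by
            conv_lhs => rw [hUH]
            simp only [Matrix.mul_assoc]
        _ = _ := by rw [hU1, Matrix.one_mul, Matrix.mul_one]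
    have hbound : ∀ (X : Matrix (Fin N) (Fin N) ℝ) (e : ℝ), 0 ≤ e → (∀ i j, |X i j| ≤ e) →
        |(Uᵀ * X * U) k k| ≤ (N : ℝ) ^ 2 * e := by
      intro X e he hX
      refine (abs_entry_mul_mul_le Uᵀ X U hX k k).trans (mul_le_mul_of_nonneg_right ?_ he)
      calc ∑ a, ∑ b, |Uᵀ k a| * |U b k| ≤ ∑ _a : Fin N, ∑ _b : Fin N, (1 : ℝ) :=
            Finset.sum_le_sum fun a _ => Finset.sum_le_sum fun b _ =>
              mul_le_one₀ (hUe a k) (abs_nonneg _) (hUe b k)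
        _ = (N : ℝ) ^ 2 := by simp [sq]
    have hsplit : hS.eigenvalues k = (Uᵀ * V * U) k k + (Uᵀ * (S - V) * U) k k := by
      rw [← Matrix.add_apply, ← Matrix.add_mul, ← Matrix.mul_add, add_sub_cancel, hdiag,
        Matrix.diagonal_apply_eq]
    have hlow : m ≤ (Uᵀ * V * U) k k := by
      have h1 : Uᵀ * V * U = (Uᵀ * Λ) * (Uᵀ * Λ)ᵀ + Uᵀ * diagonal s * U := by
        rw [hV, Matrix.mul_add, Matrix.add_mul, Matrix.transpose_mul, Matrix.transpose_transpose]
        simp only [Matrix.mul_assoc]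
      have h2 : 0 ≤ ((Uᵀ * Λ) * (Uᵀ * Λ)ᵀ) k k := by
        rw [Matrix.mul_apply]
        exact Finset.sum_nonneg fun l _ => mul_self_nonneg _
      have h3 : m ≤ (Uᵀ * diagonal s * U) k k := by
        have hone : ∑ i, U i k * U i k = 1 := by
          have := congrFun (congrFun hU1 k) k
          simpa [Matrix.mul_apply] using this
        rw [Matrix.mul_apply]
        simp only [Matrix.mul_diagonal, Matrix.transpose_apply]
        calc m = ∑ i, m * (U i k * U i k) := by rw [← Finset.mul_sum, hone, mul_one]
          _ ≤ ∑ i, U i k * s i * U i k := Finset.sum_le_sum fun i _ => by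
              nlinarith [mul_le_mul_of_nonneg_right (hms i) (mul_self_nonneg (U i k))]
      rw [h1, Matrix.add_apply]
      linarith
    have hup := hbound V _ (le_max_right _ _) hVc
    have hdev := hbound (S - V) ε₀ hε0.le fun i j => by simpa using hSV i j
    rw [abs_le] at hup hdev
    constructor <;> linarith
  intro j
  have h := key (Fintype.equivOfCardEq (Fintype.card_fin _) j)
  simpa [Matrix.IsHermitian.eigenvalues] using h

theorem exists_sigmaHat_bounds {Ω : Type*} {N r : ℕ} (hN : 0 < N)
    (Λ : Matrix (Fin N) (Fin r) ℝ) (s : Fin N → ℝ) (hs : ∀ i, 0 < s i) :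
    ∃ a b ε₀ : ℝ, 0 < a ∧ 0 < b ∧ 0 < ε₀ ∧ ∀ (P : Panel Ω N r) (T : ℕ) (ω : Ω),
      (∀ i j, |P.preCov T ω i j - (Λ * Λᵀ + diagonal s) i j| ≤ ε₀) →
      a ≤ P.sigmaHat T ω ∧ P.sigmaHat T ω ≤ b := by
  obtain ⟨a, b, ε₀, ha, hb, hε₀, h⟩ := exists_eigenvalue_bounds Λ s hs
  have hN' : (0 : ℝ) < N := Nat.cast_pos.mpr hN
  refine ⟨√((N : ℝ)⁻¹ * a), √b, ε₀, by positivity, by positivity, hε₀, fun P T ω hP => ?_⟩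
  have hev := h _ (P.preCov_isHermitian T ω) hP
  set ν := (P.preCov_isHermitian T ω).eigenvalues₀
  have hlt : N - 1 < Fintype.card (Fin N) := by rw [Fintype.card_fin]; omega
  -- The smallest eigenvalue always belongs to the sum, so the sum is bounded below whatever `r` is.
  have hmem : (⟨N - 1, hlt⟩ : Fin (Fintype.card (Fin N))) ∈
      Finset.univ.filter fun j : Fin (Fintype.card (Fin N)) => (N + 1) / 2 ≤ j.val + 1 + r := by
    simp only [Finset.mem_filter, Finset.mem_univ, true_and]
    omega
  unfold Panel.sigmaHat
  constructor
  · apply Real.sqrt_le_sqrt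
    refine mul_le_mul_of_nonneg_left ?_ (by positivity)
    exact (hev _).1.trans (Finset.single_le_sum (f := ν) (fun j _ => ha.le.trans (hev j).1) hmem)
  · apply Real.sqrt_le_sqrt
    have h1 : ∑ j : Fin (Fintype.card (Fin N)) with (N + 1) / 2 ≤ j.val + 1 + r, ν j ≤ N * b := by
      calc _ ≤ ∑ j, ν j := Finset.sum_le_univ_sum_of_nonneg fun j => ha.le.trans (hev j).1
        _ ≤ ∑ _j : Fin (Fintype.card (Fin N)), b := Finset.sum_le_sum fun j _ => (hev j).2
        _ = N * b := by simp
    calc _ ≤ (N : ℝ)⁻¹ * (N * b) := mul_le_mul_of_nonneg_left h1 (by positivity)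
      _ = b := by field_simp

end NoiseLevel

/-! ### Covariance inequalities under strong mixing. -/

section Mixing

/-- Layer cake: each integral equals the integral over `t` in `(0, M]` of the measure of `{t ≤ Y}`,
and these sets lie in `m`. -/
theorem abs_integral_sub_le_of_measures_close {Ω : Type*} {m m0 : MeasurableSpace Ω} (hm : m ≤ m0)
    (ν₁ ν₂ : Measure[m0] Ω) [IsFiniteMeasure ν₁] [IsFiniteMeasure ν₂] {Y : Ω → ℝ}
    (hY : Measurable[m] Y) {M ε : ℝ} (hY0 : ∀ ω, 0 ≤ Y ω) (hYM : ∀ ω, Y ω ≤ M) (hM : 0 ≤ M)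
    (h : ∀ A, MeasurableSet[m] A → |ν₁.real A - ν₂.real A| ≤ ε) :
    |∫ ω, Y ω ∂ν₁ - ∫ ω, Y ω ∂ν₂| ≤ M * ε := by
  have hY' : Measurable Y := hY.mono hm le_rfl
  have hinteg : ∀ (ν : Measure Ω) [IsFiniteMeasure ν], Integrable Y ν := fun ν _ =>
    Integrable.of_bound hY'.aestronglyMeasurable M
      (.of_forall fun ω => by rw [Real.norm_of_nonneg (hY0 ω)]; exact hYM ω)
  have hlc : ∀ (ν : Measure Ω) [IsFiniteMeasure ν],
      ∫ ω, Y ω ∂ν = ∫ t in Set.Ioc 0 M, ν.real {ω | t ≤ Y ω} := fun ν _ =>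
    (hinteg ν).integral_eq_integral_Ioc_meas_le (.of_forall hY0) (.of_forall hYM)
  have hinteg' : ∀ (ν : Measure Ω) [IsFiniteMeasure ν],
      Integrable (fun t => ν.real {ω | t ≤ Y ω}) (volume.restrict (Set.Ioc 0 M)) := by
    intro ν _
    have hanti : Antitone (fun t => ν.real {ω | t ≤ Y ω}) := fun s t hst =>
      measureReal_mono fun ω hω => le_trans hst hω
    refine Integrable.of_bound hanti.measurable.aestronglyMeasurable (ν.real Set.univ)
      (.of_forall fun t => ?_)
    rw [Real.norm_of_nonneg measureReal_nonneg]
    exact measureReal_mono (Set.subset_univ _)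
  rw [hlc ν₁, hlc ν₂, ← integral_sub (hinteg' ν₁) (hinteg' ν₂), ← Real.norm_eq_abs]
  have := norm_setIntegral_le_of_norm_le_const (μ := volume) (s := Set.Ioc 0 M) (C := ε)
    (f := fun t => ν₁.real {ω | t ≤ Y ω} - ν₂.real {ω | t ≤ Y ω}) (by simp)
    fun t _ => by
      rw [Real.norm_eq_abs]
      exact h _ (measurableSet_le measurable_const hY)
  refine this.trans_eq ?_
  simp [Measure.real, hM, mul_comm]

/-- The comparison of measures is used twice. For fixed `B` it replaces the indicator of `A` by `X`,
comparing `μ` restricted to `B` with `μ B • μ`; then it replaces the indicator of `B` by `Y`,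
comparing the measure with density `X` with `(∫ X) • μ`. -/
theorem abs_cov_le_of_nonneg {Ω : Type*} {m₁ m₂ m0 : MeasurableSpace Ω} (hm₁ : m₁ ≤ m0)
    (hm₂ : m₂ ≤ m0) (μ : Measure[m0] Ω) [IsProbabilityMeasure μ] {α : ℝ}
    (hα : ∀ A B, MeasurableSet[m₁] A → MeasurableSet[m₂] B →
      |μ.real (A ∩ B) - μ.real A * μ.real B| ≤ α)
    {X Y : Ω → ℝ} (hX : Measurable[m₁] X) (hY : Measurable[m₂] Y) {a b : ℝ} (ha : 0 ≤ a)
    (hb : 0 ≤ b) (hX0 : ∀ ω, 0 ≤ X ω) (hXa : ∀ ω, X ω ≤ a) (hY0 : ∀ ω, 0 ≤ Y ω)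
    (hYb : ∀ ω, Y ω ≤ b) :
    |∫ ω, X ω * Y ω ∂μ - (∫ ω, X ω ∂μ) * ∫ ω, Y ω ∂μ| ≤ b * (a * α) := by
  have hX' : Measurable X := hX.mono hm₁ le_rfl
  have hXi : Integrable X μ := Integrable.of_bound hX'.aestronglyMeasurable a
      (.of_forall fun ω => by rw [Real.norm_of_nonneg (hX0 ω)]; exact hXa ω)
  have step : ∀ B, MeasurableSet[m₂] B →
      |∫ ω in B, X ω ∂μ - μ.real B * ∫ ω, X ω ∂μ| ≤ a * α := by
    intro B hB
    have hfin : IsFiniteMeasure (μ B • μ) := μ.smul_finite (measure_ne_top μ B)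
    have := abs_integral_sub_le_of_measures_close hm₁ (μ.restrict B) (μ B • μ) hX hX0 hXa ha
      (ε := α) fun A hA => by
        rw [measureReal_restrict_apply (hm₁ A hA), measureReal_ennreal_smul_apply]
        have := hα A B hA hB
        rwa [mul_comm (μ.real A)] at this
    rwa [integral_smul_measure] at this
  have hden : ∀ B, MeasurableSet B → (μ.withDensity fun ω => ENNReal.ofReal (X ω)).real B =
      ∫ ω in B, X ω ∂μ := by
    intro B hB
    rw [Measure.real, withDensity_apply _ hB,
      ← ofReal_integral_eq_lintegral_ofReal hXi.integrableOn (.of_forall hX0),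
      ENNReal.toReal_ofReal (integral_nonneg hX0)]
  have hfin : IsFiniteMeasure (μ.withDensity fun ω => ENNReal.ofReal (X ω)) :=
    isFiniteMeasure_withDensity_ofReal hXi.2
  have hfin' : IsFiniteMeasure (ENNReal.ofReal (∫ ω, X ω ∂μ) • μ) :=
    μ.smul_finite ENNReal.ofReal_ne_top
  have := abs_integral_sub_le_of_measures_close hm₂
    (μ.withDensity fun ω => ENNReal.ofReal (X ω)) (ENNReal.ofReal (∫ ω, X ω ∂μ) • μ) hY hY0 hYb hb
    (ε := a * α) fun B hB => by
      rw [hden B (hm₂ B hB), measureReal_ennreal_smul_apply,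
        ENNReal.toReal_ofReal (integral_nonneg hX0), mul_comm (∫ ω, X ω ∂μ)]
      exact step B hB
  rw [integral_smul_measure, ENNReal.toReal_ofReal (integral_nonneg hX0),
    integral_withDensity_eq_integral_toReal_smul hX'.ennreal_ofReal
      (.of_forall fun _ => ENNReal.ofReal_lt_top)] at this
  simpa only [ENNReal.toReal_ofReal (hX0 _), smul_eq_mul] using this

/-- Adding `a` to both variables leaves the covariance unchanged and gives values in `[0, 2 * a]`,
whence the factor 4. -/
theorem abs_cov_le_of_bounded {Ω : Type*} {m₁ m₂ m0 : MeasurableSpace Ω} (hm₁ : m₁ ≤ m0)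
    (hm₂ : m₂ ≤ m0) (μ : Measure[m0] Ω) [IsProbabilityMeasure μ] {α : ℝ}
    (hα : ∀ A B, MeasurableSet[m₁] A → MeasurableSet[m₂] B →
      |μ.real (A ∩ B) - μ.real A * μ.real B| ≤ α)
    {X Y : Ω → ℝ} (hX : Measurable[m₁] X) (hY : Measurable[m₂] Y) {a : ℝ} (ha : 0 ≤ a)
    (hXa : ∀ ω, |X ω| ≤ a) (hYa : ∀ ω, |Y ω| ≤ a) :
    |∫ ω, X ω * Y ω ∂μ - (∫ ω, X ω ∂μ) * ∫ ω, Y ω ∂μ| ≤ 4 * a ^ 2 * α := by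
  have hX' : Measurable X := hX.mono hm₁ le_rfl
  have hY' : Measurable Y := hY.mono hm₂ le_rfl
  have hXi : Integrable X μ := Integrable.of_bound hX'.aestronglyMeasurable a
    (.of_forall fun ω => by rw [Real.norm_eq_abs]; exact hXa ω)
  have hYi : Integrable Y μ := Integrable.of_bound hY'.aestronglyMeasurable a
    (.of_forall fun ω => by rw [Real.norm_eq_abs]; exact hYa ω)
  have hXYi : Integrable (fun ω => X ω * Y ω) μ :=
    Integrable.of_bound (hX'.mul hY').aestronglyMeasurable (a * a)
      (.of_forall fun ω => by
        rw [Real.norm_eq_abs, abs_mul]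
        exact mul_le_mul (hXa ω) (hYa ω) (abs_nonneg _) ha)
  have h := abs_cov_le_of_nonneg hm₁ hm₂ μ hα (hX.add_const a) (hY.add_const a)
    (a := 2 * a) (b := 2 * a) (by positivity) (by positivity)
    (fun ω => by linarith [(abs_le.mp (hXa ω)).1]) (fun ω => by linarith [(abs_le.mp (hXa ω)).2])
    (fun ω => by linarith [(abs_le.mp (hYa ω)).1]) (fun ω => by linarith [(abs_le.mp (hYa ω)).2])
  have e1 : ∫ ω, (X ω + a) ∂μ = ∫ ω, X ω ∂μ + a := by
    rw [integral_add hXi (integrable_const _)]; simp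
  have e2 : ∫ ω, (Y ω + a) ∂μ = ∫ ω, Y ω ∂μ + a := by
    rw [integral_add hYi (integrable_const _)]; simp
  have e3 : ∫ ω, (X ω + a) * (Y ω + a) ∂μ =
      ∫ ω, X ω * Y ω ∂μ + a * ∫ ω, X ω ∂μ + a * ∫ ω, Y ω ∂μ + a * a := by
    have : ∀ ω, (X ω + a) * (Y ω + a) = X ω * Y ω + a * X ω + a * Y ω + a * a := fun ω => by ring
    simp_rw [this]
    have i1 : Integrable (fun ω => X ω * Y ω + a * X ω) μ := hXYi.add (hXi.const_mul a)
    have i2 : Integrable (fun ω => X ω * Y ω + a * X ω + a * Y ω) μ := i1.add (hYi.const_mul a)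
    rw [integral_add i2 (integrable_const _), integral_add i1 (hYi.const_mul a),
      integral_add hXYi (hXi.const_mul a), integral_const_mul, integral_const_mul]
    simp
  rw [e1, e2, e3] at h
  convert h using 1
  · congr 1; ring
  · ring

theorem abs_rpow_two_le {x a p : ℝ} (ha : 0 < a) (hp : 2 ≤ p) (hx : a < |x|) :
    |x| ^ 2 ≤ a ^ (2 - p) * |x| ^ p := by
  have hx0 : 0 < |x| := ha.trans hx
  have h1 : |x| ^ (2 - p) ≤ a ^ (2 - p) :=
    Real.rpow_le_rpow_of_nonpos ha hx.le (by linarith)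
  calc |x| ^ 2 = |x| ^ (2 - p) * |x| ^ p := by
        rw [← Real.rpow_add hx0]; norm_num
    _ ≤ _ := mul_le_mul_of_nonneg_right h1 (by positivity)

theorem abs_le_one_add_rpow (x : ℝ) {p : ℝ} (hp : 1 ≤ p) : |x| ≤ 1 + |x| ^ p := by
  rcases le_total |x| 1 with h | h
  · linarith [Real.rpow_nonneg (abs_nonneg x) p]
  · linarith [Real.self_le_rpow_of_one_le h hp]

/-- Truncation at level `a`. -/
noncomputable def trunc (a x : ℝ) : ℝ := if |x| ≤ a then x else 0

theorem measurable_trunc (a : ℝ) : Measurable (trunc a) :=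
  Measurable.ite (measurableSet_le measurable_id.abs measurable_const) measurable_id
    measurable_const

theorem abs_trunc_le {a : ℝ} (ha : 0 ≤ a) (x : ℝ) : |trunc a x| ≤ a := by
  unfold trunc
  split_ifs with h
  · exact h
  · simpa using ha

theorem abs_sub_trunc_le {a p : ℝ} (ha : 1 ≤ a) (hp : 2 ≤ p) (x : ℝ) :
    |x - trunc a x| ≤ a ^ (2 - p) * |x| ^ p := by
  have ha0 : 0 < a := by linarith
  unfold trunc
  split_ifs with h
  · rw [sub_self, abs_zero]; positivity
  · rw [not_le] at h
    rw [sub_zero]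
    refine le_trans ?_ (abs_rpow_two_le ha0 hp h)
    nlinarith

/-- The products differ only if the larger factor exceeds `a`, and then the square of that factor,
which dominates `|x * y|`, is at most `a ^ (2 - p)` times its `p`-th power. -/
theorem abs_mul_sub_trunc_le {a p : ℝ} (ha : 1 ≤ a) (hp : 2 ≤ p) (x y : ℝ) :
    |x * y - trunc a x * trunc a y| ≤ a ^ (2 - p) * (|x| ^ p + |y| ^ p) := by
  have ha0 : 0 < a := by linarith
  have hmain : a < max |x| |y| → |x * y| ≤ a ^ (2 - p) * (|x| ^ p + |y| ^ p) := by
    intro h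
    rw [abs_mul, mul_add]
    have hpx : 0 ≤ a ^ (2 - p) * |x| ^ p := by positivity
    have hpy : 0 ≤ a ^ (2 - p) * |y| ^ p := by positivity
    rcases le_total |x| |y| with hxy | hxy
    · rw [max_eq_right hxy] at h
      have := abs_rpow_two_le ha0 hp h
      nlinarith [abs_nonneg x, abs_nonneg y]
    · rw [max_eq_left hxy] at h
      have := abs_rpow_two_le ha0 hp h
      nlinarith [abs_nonneg x, abs_nonneg y]
  unfold trunc
  split_ifs with h1 h2 h2
  · rw [sub_self, abs_zero]; positivity
  · rw [mul_zero, sub_zero]; exact hmain (lt_max_of_lt_right (not_le.mp h2))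
  · rw [zero_mul, sub_zero]; exact hmain (lt_max_of_lt_left (not_le.mp h1))
  · rw [zero_mul, sub_zero]; exact hmain (lt_max_of_lt_left (not_le.mp h1))

theorem integrable_of_integrable_rpow {Ω : Type*} [MeasurableSpace Ω] {μ : Measure Ω}
    [IsFiniteMeasure μ] {X : Ω → ℝ} (hX : Measurable X) {p : ℝ} (hp : 1 ≤ p)
    (hXp : Integrable (fun ω => |X ω| ^ p) μ) : Integrable X μ :=
  ((integrable_const 1).add hXp).mono' hX.aestronglyMeasurable
    (.of_forall fun ω => abs_le_one_add_rpow (X ω) hp)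

theorem integrable_mul_of_integrable_rpow {Ω : Type*} [MeasurableSpace Ω] {μ : Measure Ω}
    [IsFiniteMeasure μ] {X Y : Ω → ℝ} (hX : Measurable X) (hY : Measurable Y) {p : ℝ} (hp : 2 ≤ p)
    (hXp : Integrable (fun ω => |X ω| ^ p) μ) (hYp : Integrable (fun ω => |Y ω| ^ p) μ) :
    Integrable (fun ω => X ω * Y ω) μ := by
  refine ((integrable_const (1 : ℝ)).add (hXp.add hYp)).mono' (hX.mul hY).aestronglyMeasurable
    (.of_forall fun ω => ?_)
  have h := abs_mul_sub_trunc_le le_rfl hp (X ω) (Y ω)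
  rw [Real.one_rpow, one_mul] at h
  have h2 : |trunc 1 (X ω) * trunc 1 (Y ω)| ≤ 1 := by
    rw [abs_mul]
    exact mul_le_one₀ (abs_trunc_le zero_le_one _) (abs_nonneg _) (abs_trunc_le zero_le_one _)
  simp only [Real.norm_eq_abs, Pi.add_apply]
  have h3 := abs_add_le (X ω * Y ω - trunc 1 (X ω) * trunc 1 (Y ω))
    (trunc 1 (X ω) * trunc 1 (Y ω))
  rw [sub_add_cancel] at h3
  linarith

theorem abs_cov_le_of_truncation {Ω : Type*} {m₁ m₂ m0 : MeasurableSpace Ω} (hm₁ : m₁ ≤ m0)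
    (hm₂ : m₂ ≤ m0) (μ : Measure[m0] Ω) [IsProbabilityMeasure μ] {α : ℝ}
    (hα : ∀ A B, MeasurableSet[m₁] A → MeasurableSet[m₂] B →
      |μ.real (A ∩ B) - μ.real A * μ.real B| ≤ α)
    {X Y : Ω → ℝ} (hX : Measurable[m₁] X) (hY : Measurable[m₂] Y) {p B a : ℝ} (hp : 2 ≤ p)
    (hXp : Integrable (fun ω => |X ω| ^ p) μ) (hYp : Integrable (fun ω => |Y ω| ^ p) μ)
    (hXB : ∫ ω, |X ω| ^ p ∂μ ≤ B) (hYB : ∫ ω, |Y ω| ^ p ∂μ ≤ B) (ha : 1 ≤ a) :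
    |∫ ω, X ω * Y ω ∂μ - (∫ ω, X ω ∂μ) * ∫ ω, Y ω ∂μ| ≤
      4 * a ^ 2 * α + a ^ (2 - p) * (2 * B + 2 * (B * (1 + 2 * B))) := by
  have ha0 : 0 < a := by linarith
  have hX' : Measurable X := hX.mono hm₁ le_rfl
  have hY' : Measurable Y := hY.mono hm₂ le_rfl
  have hB0 : 0 ≤ B := (integral_nonneg fun ω => by positivity).trans hXB
  have hXi := integrable_of_integrable_rpow hX' (by linarith) hXp
  have hYi := integrable_of_integrable_rpow hY' (by linarith) hYp
  have hXYi := integrable_mul_of_integrable_rpow hX' hY' hp hXp hYp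
  have htX' : Measurable fun ω => trunc a (X ω) := (measurable_trunc a).comp hX'
  have htY' : Measurable fun ω => trunc a (Y ω) := (measurable_trunc a).comp hY'
  have htX : Integrable (fun ω => trunc a (X ω)) μ :=
    Integrable.of_bound htX'.aestronglyMeasurable a (.of_forall fun ω => abs_trunc_le ha0.le _)
  have htY : Integrable (fun ω => trunc a (Y ω)) μ :=
    Integrable.of_bound htY'.aestronglyMeasurable a (.of_forall fun ω => abs_trunc_le ha0.le _)
  have htXY : Integrable (fun ω => trunc a (X ω) * trunc a (Y ω)) μ :=
    Integrable.of_bound (htX'.mul htY').aestronglyMeasurable (a * a) (.of_forall fun ω => by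
      rw [Real.norm_eq_abs, abs_mul]
      exact mul_le_mul (abs_trunc_le ha0.le _) (abs_trunc_le ha0.le _) (abs_nonneg _) ha0.le)
  set q := a ^ (2 - p) with hq
  have hq0 : 0 ≤ q := by positivity
  have hq1 : q ≤ 1 := Real.rpow_le_one_of_one_le_of_nonpos ha (by linarith)
  have h0 := abs_cov_le_of_bounded hm₁ hm₂ μ hα ((measurable_trunc a).comp hX)
    ((measurable_trunc a).comp hY) ha0.le (fun ω => abs_trunc_le ha0.le _)
    (fun ω => abs_trunc_le ha0.le _)
  have h1 : |∫ ω, X ω * Y ω ∂μ - ∫ ω, trunc a (X ω) * trunc a (Y ω) ∂μ| ≤ q * (2 * B) := by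
    rw [← integral_sub hXYi htXY]
    refine (abs_integral_le_integral_abs).trans ?_
    calc _ ≤ ∫ ω, q * (|X ω| ^ p + |Y ω| ^ p) ∂μ :=
          integral_mono (hXYi.sub htXY).abs ((hXp.add hYp).const_mul q)
            fun ω => abs_mul_sub_trunc_le ha hp _ _
      _ = q * (∫ ω, |X ω| ^ p ∂μ + ∫ ω, |Y ω| ^ p ∂μ) := by
          rw [integral_const_mul, integral_add hXp hYp]
      _ ≤ _ := mul_le_mul_of_nonneg_left (by linarith) hq0
  have hdiff : ∀ {Z : Ω → ℝ}, Integrable Z μ → Integrable (fun ω => trunc a (Z ω)) μ →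
      Integrable (fun ω => |Z ω| ^ p) μ → ∫ ω, |Z ω| ^ p ∂μ ≤ B →
      |∫ ω, Z ω ∂μ - ∫ ω, trunc a (Z ω) ∂μ| ≤ q * B := by
    intro Z hZ htZ hZp hZB
    rw [← integral_sub hZ htZ]
    refine (abs_integral_le_integral_abs).trans ?_
    calc _ ≤ ∫ ω, q * |Z ω| ^ p ∂μ :=
          integral_mono (hZ.sub htZ).abs (hZp.const_mul q) fun ω => abs_sub_trunc_le ha hp _
      _ = q * ∫ ω, |Z ω| ^ p ∂μ := integral_const_mul _ _
      _ ≤ _ := mul_le_mul_of_nonneg_left hZB hq0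
  have hmean : ∀ {Z : Ω → ℝ}, Integrable Z μ → Integrable (fun ω => |Z ω| ^ p) μ →
      ∫ ω, |Z ω| ^ p ∂μ ≤ B → |∫ ω, Z ω ∂μ| ≤ 1 + B := by
    intro Z hZ hZp hZB
    refine (abs_integral_le_integral_abs).trans ?_
    calc _ ≤ ∫ ω, (1 + |Z ω| ^ p) ∂μ := integral_mono hZ.abs ((integrable_const 1).add hZp)
            fun ω => abs_le_one_add_rpow _ (by linarith)
      _ = 1 + ∫ ω, |Z ω| ^ p ∂μ := by rw [integral_add (integrable_const 1) hZp]; simp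
      _ ≤ _ := by linarith
  have hdX := hdiff hXi htX hXp hXB
  have hdY := hdiff hYi htY hYp hYB
  have hmX := hmean hXi hXp hXB
  have hmY := hmean hYi hYp hYB
  simp only [Function.comp_apply] at h0
  set x := ∫ ω, X ω ∂μ
  set y := ∫ ω, Y ω ∂μ
  set x' := ∫ ω, trunc a (X ω) ∂μ
  set y' := ∫ ω, trunc a (Y ω) ∂μ
  have hx' : |x'| ≤ 1 + 2 * B := by
    have h3 : q * B ≤ B := mul_le_of_le_one_left hB0 hq1
    rw [abs_le] at hdX hmX ⊢
    constructor <;> linarith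
  have h2 : |x * y - x' * y'| ≤ q * (2 * (B * (1 + 2 * B))) := by
    have e : x * y - x' * y' = (x - x') * y + x' * (y - y') := by ring
    rw [e]
    refine (abs_add_le _ _).trans ?_
    rw [abs_mul, abs_mul]
    have h3 : |x - x'| * |y| ≤ q * B * (1 + 2 * B) :=
      mul_le_mul hdX (hmY.trans (by linarith)) (abs_nonneg _) (by positivity)
    have h4 : |x'| * |y - y'| ≤ (1 + 2 * B) * (q * B) :=
      mul_le_mul hx' hdY (abs_nonneg _) (by positivity)
    linarith
  rw [mul_add]
  rw [abs_le] at h0 h1 h2 ⊢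
  constructor <;> linarith

/-- Davydov's covariance inequality for strongly mixing σ-algebras. -/
theorem abs_cov_le_rpow {Ω : Type*} {m₁ m₂ m0 : MeasurableSpace Ω} (hm₁ : m₁ ≤ m0)
    (hm₂ : m₂ ≤ m0) (μ : Measure[m0] Ω) [IsProbabilityMeasure μ] {α : ℝ} (hα0 : 0 ≤ α)
    (hα1 : α ≤ 1)
    (hα : ∀ A B, MeasurableSet[m₁] A → MeasurableSet[m₂] B →
      |μ.real (A ∩ B) - μ.real A * μ.real B| ≤ α)
    {X Y : Ω → ℝ} (hX : Measurable[m₁] X) (hY : Measurable[m₂] Y) {δ B : ℝ} (hδ : 0 < δ)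
    (hXp : Integrable (fun ω => |X ω| ^ (2 + δ)) μ) (hYp : Integrable (fun ω => |Y ω| ^ (2 + δ)) μ)
    (hXB : ∫ ω, |X ω| ^ (2 + δ) ∂μ ≤ B) (hYB : ∫ ω, |Y ω| ^ (2 + δ) ∂μ ≤ B) :
    |∫ ω, X ω * Y ω ∂μ - (∫ ω, X ω ∂μ) * ∫ ω, Y ω ∂μ| ≤
      (4 + (2 * B + 2 * (B * (1 + 2 * B)))) * α ^ (δ / (2 + δ)) := by
  have h := fun a (ha : (1 : ℝ) ≤ a) => abs_cov_le_of_truncation hm₁ hm₂ μ hα hX hY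
    (by linarith : (2 : ℝ) ≤ 2 + δ) hXp hYp hXB hYB ha
  have hd : 0 < δ / (2 + δ) := by positivity
  -- With `α = 0` the truncation level can tend to infinity. Otherwise the level `α ^ (-(1 / (2 +
  -- δ)))` balances the two terms: both `a ^ 2 * α` and `a ^ (-δ)` become `α ^ (δ / (2 + δ))`.
  rcases hα0.eq_or_lt with h0 | hpos
  · subst h0
    rw [Real.zero_rpow hd.ne', mul_zero]
    have hlim : Tendsto (fun a : ℝ => a ^ (2 - (2 + δ)) * (2 * B + 2 * (B * (1 + 2 * B)))) atTop
        (𝓝 (0 * (2 * B + 2 * (B * (1 + 2 * B))))) := by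
      refine Tendsto.mul_const _ ?_
      have := tendsto_rpow_neg_atTop hδ
      simpa using this
    rw [zero_mul] at hlim
    refine ge_of_tendsto hlim ?_
    filter_upwards [eventually_ge_atTop 1] with a ha
    simpa using h a ha
  · have ha : (1 : ℝ) ≤ α ^ (-(1 / (2 + δ))) :=
      Real.one_le_rpow_of_pos_of_le_one_of_nonpos hpos hα1 (by
        have : 0 < 1 / (2 + δ) := by positivity
        linarith)
    refine (h _ ha).trans_eq ?_
    have e1 : (α ^ (-(1 / (2 + δ)))) ^ 2 * α = α ^ (δ / (2 + δ)) := by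
      rw [← Real.rpow_natCast, ← Real.rpow_mul hpos.le]
      nth_rewrite 2 [← Real.rpow_one α]
      rw [← Real.rpow_add hpos]
      congr 1
      push_cast
      field_simp
      ring
    have e2 : (α ^ (-(1 / (2 + δ)))) ^ (2 - (2 + δ)) = α ^ (δ / (2 + δ)) := by
      rw [← Real.rpow_mul hpos.le]
      congr 1
      field_simp
      ring
    rw [e2, mul_assoc, e1]
    ring

end Mixing

/-! ### Root-`T` rate for sample means of a mixing array. -/

section SampleMeans

/-- Boundedness matters because the real `sSup` of an unbounded set is 0 by convention; with it the
coefficients do dominate each of their members. -/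
theorem le_one_of_mem_alphaCoef_set {Ω : Type*} (m₁ m₂ : MeasurableSpace Ω) [MeasurableSpace Ω]
    (μ : Measure Ω) [IsProbabilityMeasure μ] :
    ∀ x ∈ {x : ℝ | ∃ A B : Set Ω, MeasurableSet[m₁] A ∧ MeasurableSet[m₂] B ∧
      x = |μ.real (A ∩ B) - μ.real A * μ.real B|}, x ≤ 1 := by
  rintro x ⟨A, B, -, -, rfl⟩
  have h1 : 0 ≤ μ.real (A ∩ B) := measureReal_nonneg
  have h2 : μ.real (A ∩ B) ≤ 1 := measureReal_le_one
  have h3 : 0 ≤ μ.real A * μ.real B := mul_nonneg measureReal_nonneg measureReal_nonneg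
  have h4 : μ.real A * μ.real B ≤ 1 :=
    mul_le_one₀ measureReal_le_one measureReal_nonneg measureReal_le_one
  rw [abs_le]
  constructor <;> linarith

theorem alphaCoef_le_one {Ω : Type*} (m₁ m₂ : MeasurableSpace Ω) [MeasurableSpace Ω]
    (μ : Measure Ω) [IsProbabilityMeasure μ] : alphaCoef μ m₁ m₂ ≤ 1 :=
  csSup_le ⟨_, ∅, ∅, @MeasurableSet.empty _ m₁, @MeasurableSet.empty _ m₂, rfl⟩
    (le_one_of_mem_alphaCoef_set m₁ m₂ μ)

theorem abs_le_alphaCoef {Ω : Type*} {m₁ m₂ : MeasurableSpace Ω} [MeasurableSpace Ω]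
    (μ : Measure Ω) [IsProbabilityMeasure μ] {A B : Set Ω}
    (hA : MeasurableSet[m₁] A) (hB : MeasurableSet[m₂] B) :
    |μ.real (A ∩ B) - μ.real A * μ.real B| ≤ alphaCoef μ m₁ m₂ :=
  le_csSup ⟨1, le_one_of_mem_alphaCoef_set m₁ m₂ μ⟩ ⟨A, B, hA, hB, rfl⟩

theorem mixingCoef_le_one {Ω E : Type*} [MeasurableSpace Ω] [MeasurableSpace E] (μ : Measure Ω)
    [IsProbabilityMeasure μ] (Z : ℕ → ℕ → Ω → E) (k : ℕ) : mixingCoef μ Z k ≤ 1 :=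
  ciSup_le fun _ => alphaCoef_le_one _ _ μ

theorem alphaCoef_le_mixingCoef {Ω E : Type*} [MeasurableSpace Ω] [MeasurableSpace E]
    (μ : Measure Ω) [IsProbabilityMeasure μ] (Z : ℕ → ℕ → Ω → E) (T s k : ℕ) :
    alphaCoef μ (sigmaBlock (Z T) 1 s) (sigmaBlock (Z T) (s + k) T) ≤ mixingCoef μ Z k :=
  le_ciSup (f := fun p : ℕ × ℕ =>
    alphaCoef μ (sigmaBlock (Z p.1) 1 p.2) (sigmaBlock (Z p.1) (p.2 + k) p.1))
    ⟨1, by rintro _ ⟨p, rfl⟩; exact alphaCoef_le_one _ _ μ⟩ (T, s)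

theorem mixingCoef_nonneg {Ω E : Type*} [MeasurableSpace Ω] [MeasurableSpace E] (μ : Measure Ω)
    [IsProbabilityMeasure μ] (Z : ℕ → ℕ → Ω → E) (k : ℕ) : 0 ≤ mixingCoef μ Z k :=
  ((abs_nonneg _).trans (abs_le_alphaCoef μ (@MeasurableSet.empty _ (sigmaBlock (Z 0) 1 0))
    (@MeasurableSet.empty _ (sigmaBlock (Z 0) (0 + k) 0)))).trans
    (alphaCoef_le_mixingCoef μ Z 0 0 k)

theorem sum_comp_sub_le_tsum {c : ℕ → ℝ} (hc0 : ∀ k, 0 ≤ c k) (hc : Summable c)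
    (F : Finset ℕ) (f : ℕ → ℕ) (hf : Set.InjOn f F) : ∑ t ∈ F, c (f t) ≤ ∑' k, c k := by
  rw [← Finset.sum_image (f := c) hf]
  exact hc.sum_le_tsum _ fun k _ => hc0 k

/-- With truncated subtraction `(t - s) + (s - t)` is `|t - s|`. For fixed `s` every gap occurs at
most once on either side, hence the factor 2. -/
theorem sum_sum_gap_le {c : ℕ → ℝ} (hc0 : ∀ k, 0 ≤ c k) (hc : Summable c) (n : ℕ) :
    ∑ s ∈ Finset.Icc 1 n, ∑ t ∈ Finset.Icc 1 n, c ((t - s) + (s - t)) ≤ 2 * n * ∑' k, c k := by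
  have inner : ∀ s ∈ Finset.Icc 1 n,
      ∑ t ∈ Finset.Icc 1 n, c ((t - s) + (s - t)) ≤ 2 * ∑' k, c k := by
    intro s _
    rw [← Finset.sum_filter_add_sum_filter_not (Finset.Icc 1 n) (fun t => s ≤ t)]
    have h1 := sum_comp_sub_le_tsum hc0 hc ((Finset.Icc 1 n).filter fun t => s ≤ t)
      (fun t => (t - s) + (s - t)) (by
        intro a ha b hb hab
        simp only [Finset.coe_filter, Set.mem_ofPred_eq] at ha hb hab
        omega)
    have h2 := sum_comp_sub_le_tsum hc0 hc ((Finset.Icc 1 n).filter fun t => ¬ s ≤ t)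
      (fun t => (t - s) + (s - t)) (by
        intro a ha b hb hab
        simp only [Finset.coe_filter, Set.mem_ofPred_eq] at ha hb hab
        omega)
    linarith
  calc _ ≤ ∑ _s ∈ Finset.Icc 1 n, 2 * ∑' k, c k := Finset.sum_le_sum inner
    _ = _ := by simp; ring

theorem integral_sq_sum_le {Ω : Type*} [MeasurableSpace Ω] (μ : Measure Ω)
    [IsProbabilityMeasure μ] (n : ℕ) (ξ : ℕ → Ω → ℝ) (m : ℝ) {c : ℕ → ℝ} (hc0 : ∀ k, 0 ≤ c k)
    (hc : Summable c) (hξ : ∀ t ∈ Finset.Icc 1 n, Integrable (ξ t) μ ∧ ∫ ω, ξ t ω ∂μ = m)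
    (hξξ : ∀ s ∈ Finset.Icc 1 n, ∀ t ∈ Finset.Icc 1 n, Integrable (fun ω => ξ s ω * ξ t ω) μ)
    (hcov : ∀ s k, 1 ≤ s → s + k ≤ n → |∫ ω, ξ s ω * ξ (s + k) ω ∂μ - m * m| ≤ c k) :
    Integrable (fun ω => (∑ t ∈ Finset.Icc 1 n, (ξ t ω - m)) ^ 2) μ ∧
      ∫ ω, (∑ t ∈ Finset.Icc 1 n, (ξ t ω - m)) ^ 2 ∂μ ≤ 2 * n * ∑' k, c k := by
  have hexp : ∀ ω, (∑ t ∈ Finset.Icc 1 n, (ξ t ω - m)) ^ 2 =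
      ∑ s ∈ Finset.Icc 1 n, ∑ t ∈ Finset.Icc 1 n, (ξ s ω - m) * (ξ t ω - m) := by
    intro ω
    rw [sq, Finset.sum_mul_sum]
  have hterm : ∀ s ∈ Finset.Icc 1 n, ∀ t ∈ Finset.Icc 1 n,
      Integrable (fun ω => (ξ s ω - m) * (ξ t ω - m)) μ ∧
      ∫ ω, (ξ s ω - m) * (ξ t ω - m) ∂μ = ∫ ω, ξ s ω * ξ t ω ∂μ - m * m := by
    intro s hs t ht
    have e : ∀ ω, (ξ s ω - m) * (ξ t ω - m) =
        ξ s ω * ξ t ω - (m * ξ s ω + m * ξ t ω) + m * m := fun ω => by ring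
    simp_rw [e]
    have i1 : Integrable (fun ω => m * ξ s ω + m * ξ t ω) μ :=
      ((hξ s hs).1.const_mul m).add ((hξ t ht).1.const_mul m)
    have i2 : Integrable (fun ω => ξ s ω * ξ t ω - (m * ξ s ω + m * ξ t ω)) μ :=
      (hξξ s hs t ht).sub i1
    refine ⟨i2.add (integrable_const _), ?_⟩
    rw [integral_add i2 (integrable_const _), integral_sub (hξξ s hs t ht) i1,
      integral_add ((hξ s hs).1.const_mul m) ((hξ t ht).1.const_mul m), integral_const_mul,
      integral_const_mul, (hξ s hs).2, (hξ t ht).2]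
    simp only [integral_const, probReal_univ, smul_eq_mul, one_mul]
    ring
  have hbound : ∀ s ∈ Finset.Icc 1 n, ∀ t ∈ Finset.Icc 1 n,
      ∫ ω, (ξ s ω - m) * (ξ t ω - m) ∂μ ≤ c ((t - s) + (s - t)) := by
    intro s hs t ht
    rw [(hterm s hs t ht).2]
    rw [Finset.mem_Icc] at hs ht
    rcases le_total s t with hst | hst
    · have := hcov s (t - s) hs.1 (by omega)
      rw [show s + (t - s) = t by omega] at this
      rw [show (t - s) + (s - t) = t - s by omega]
      exact (le_abs_self _).trans this
    · have := hcov t (s - t) ht.1 (by omega)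
      rw [show t + (s - t) = s by omega] at this
      rw [show (t - s) + (s - t) = s - t by omega]
      simp_rw [mul_comm (ξ s _)]
      exact (le_abs_self _).trans this
  simp_rw [hexp]
  have hi : ∀ s ∈ Finset.Icc 1 n, Integrable
      (fun ω => ∑ t ∈ Finset.Icc 1 n, (ξ s ω - m) * (ξ t ω - m)) μ := fun s hs =>
    integrable_finsetSum _ fun t ht => (hterm s hs t ht).1
  refine ⟨integrable_finsetSum _ hi, ?_⟩
  rw [integral_finsetSum _ hi]
  refine (Finset.sum_le_sum fun s hs => ?_).trans (sum_sum_gap_le hc0 hc n)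
  rw [integral_finsetSum _ fun t ht => (hterm s hs t ht).1]
  exact Finset.sum_le_sum fun t ht => hbound s hs t ht

theorem measure_mean_deviation_le {Ω : Type*} [MeasurableSpace Ω] (μ : Measure Ω)
    [IsProbabilityMeasure μ] (n : ℕ) (hn : 0 < n) (ξ : ℕ → Ω → ℝ) (m C : ℝ)
    (hi : Integrable (fun ω => (∑ t ∈ Finset.Icc 1 n, (ξ t ω - m)) ^ 2) μ)
    (hC : ∫ ω, (∑ t ∈ Finset.Icc 1 n, (ξ t ω - m)) ^ 2 ∂μ ≤ n * C) {e : ℝ} (he : 0 < e) :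
    μ.real {ω | e < |(n : ℝ)⁻¹ * ∑ t ∈ Finset.Icc 1 n, ξ t ω - m|} ≤ C / (n * e ^ 2) := by
  have hn' : (0 : ℝ) < n := Nat.cast_pos.mpr hn
  have hsub : {ω | e < |(n : ℝ)⁻¹ * ∑ t ∈ Finset.Icc 1 n, ξ t ω - m|} ⊆
      {ω | (n * e) ^ 2 ≤ (∑ t ∈ Finset.Icc 1 n, (ξ t ω - m)) ^ 2} := by
    intro ω hω
    simp only [Set.mem_ofPred_eq] at hω ⊢
    have e1 : ∑ t ∈ Finset.Icc 1 n, (ξ t ω - m) =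
        n * ((n : ℝ)⁻¹ * ∑ t ∈ Finset.Icc 1 n, ξ t ω - m) := by
      rw [Finset.sum_sub_distrib, mul_sub, mul_inv_cancel_left₀ hn'.ne']
      simp
    rw [e1, ← sq_abs (_ * (_ - m)), abs_mul, abs_of_pos hn']
    gcongr
  have hmarkov := mul_meas_ge_le_integral_of_nonneg (μ := μ) (.of_forall fun ω => sq_nonneg
    (∑ t ∈ Finset.Icc 1 n, (ξ t ω - m))) hi ((n * e) ^ 2)
  refine (measureReal_mono hsub).trans ?_
  rw [le_div_iff₀ (by positivity)]
  have h2 := hmarkov.trans hC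
  have h3 : n * (μ.real {ω | (n * e) ^ 2 ≤ (∑ t ∈ Finset.Icc 1 n, (ξ t ω - m)) ^ 2} * (n * e ^ 2))
      ≤ n * C := by
    refine le_trans (le_of_eq ?_) h2
    ring
  exact le_of_mul_le_mul_left h3 hn'

/-- Sample means of a function of a stationary strongly mixing array converge at the rate
`T ^ (-1/2)`. -/
theorem isBigOp_sample_mean {Ω E : Type*} [MeasurableSpace Ω] [MeasurableSpace E] (μ : Measure Ω)
    [IsProbabilityMeasure μ] (Z : ℕ → ℕ → Ω → E) {δ : ℝ} (hδ : 0 < δ)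
    (hZm : ∀ T t, 1 ≤ t → t ≤ T → Measurable (Z T t))
    (hZs : ∀ T t, 1 ≤ t → t ≤ T → IdentDistrib (Z T t) (Z 1 1) μ μ)
    (hsum : Summable fun k => mixingCoef μ Z k ^ (δ / (2 + δ)))
    (h : E → ℝ) (hh : Measurable h) (hinteg : Integrable (fun ω => |h (Z 1 1 ω)| ^ (2 + δ)) μ)
    (T0 : ℕ → ℕ) {ρ : ℝ} (hρ0 : 0 < ρ) (hρ1 : ρ < 1)
    (hT0 : Tendsto (fun T : ℕ => (T0 T : ℝ) / (T : ℝ)) atTop (𝓝 ρ)) :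
    IsBigOp μ (fun T ω => (T0 T : ℝ)⁻¹ * ∑ t ∈ Finset.Icc 1 (T0 T), h (Z T t ω) -
      ∫ ω, h (Z 1 1 ω) ∂μ) (fun T => (T : ℝ) ^ (-(1 / 2) : ℝ)) := by
  set m := ∫ ω, h (Z 1 1 ω) ∂μ with hm
  set B := ∫ ω, |h (Z 1 1 ω)| ^ (2 + δ) ∂μ with hB
  have hB0 : 0 ≤ B := integral_nonneg fun ω => by positivity
  set D := 4 + (2 * B + 2 * (B * (1 + 2 * B))) with hD
  have hD0 : 0 ≤ D := by positivity
  set c : ℕ → ℝ := fun k => D * mixingCoef μ Z k ^ (δ / (2 + δ)) with hc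
  have hc0 : ∀ k, 0 ≤ c k := fun k =>
    mul_nonneg hD0 (Real.rpow_nonneg (mixingCoef_nonneg μ Z k) _)
  have hcs : Summable c := hsum.mul_left D
  set C := 2 * ∑' k, c k with hC
  have hC0 : 0 ≤ C := mul_nonneg zero_le_two (tsum_nonneg hc0)
  have hpow : Measurable fun z : E => |h z| ^ (2 + δ) := by fun_prop
  have hmom : ∀ T t, 1 ≤ t → t ≤ T → Integrable (fun ω => |h (Z T t ω)| ^ (2 + δ)) μ ∧
      ∫ ω, |h (Z T t ω)| ^ (2 + δ) ∂μ = B := fun T t h1 h2 =>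
    ⟨((hZs T t h1 h2).comp hpow).integrable_iff.mpr hinteg, ((hZs T t h1 h2).comp hpow).integral_eq⟩
  have hhm : ∀ T t, 1 ≤ t → t ≤ T → Measurable fun ω => h (Z T t ω) := fun T t h1 h2 =>
    hh.comp (hZm T t h1 h2)
  have hmean : ∀ T t, 1 ≤ t → t ≤ T → Integrable (fun ω => h (Z T t ω)) μ ∧
      ∫ ω, h (Z T t ω) ∂μ = m := fun T t h1 h2 =>
    ⟨integrable_of_integrable_rpow (hhm T t h1 h2) (by linarith) (hmom T t h1 h2).1,
      ((hZs T t h1 h2).comp hh).integral_eq⟩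
  have hcov : ∀ T s k, 1 ≤ s → s + k ≤ T →
      |∫ ω, h (Z T s ω) * h (Z T (s + k) ω) ∂μ - m * m| ≤ c k := by
    intro T s k hs hk
    have hblock : ∀ a b, 1 ≤ a → b ≤ T → sigmaBlock (Z T) a b ≤ ‹MeasurableSpace Ω› := by
      intro a b ha hb
      refine iSup₂_le fun t ht => ?_
      exact (hZm T t (ha.trans ht.1) (ht.2.trans hb)).comap_le
    have hmem : ∀ a b t, a ≤ t → t ≤ b → Measurable[sigmaBlock (Z T) a b] (fun ω => h (Z T t ω)) := by
      intro a b t ha hb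
      have h1 : MeasurableSpace.comap (Z T t) inferInstance ≤ sigmaBlock (Z T) a b :=
        le_iSup₂ (f := fun t (_ : t ∈ Set.Icc a b) =>
          MeasurableSpace.comap (Z T t) inferInstance) t ⟨ha, hb⟩
      exact hh.comp ((comap_measurable (Z T t)).mono h1 le_rfl)
    have := abs_cov_le_rpow (hblock 1 s le_rfl (by omega)) (hblock (s + k) T (by omega) le_rfl) μ
      (mixingCoef_nonneg μ Z k) (mixingCoef_le_one μ Z k)
      (fun A B hA hB => (abs_le_alphaCoef μ hA hB).trans (alphaCoef_le_mixingCoef μ Z T s k))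
      (hmem 1 s s hs le_rfl) (hmem (s + k) T (s + k) le_rfl hk) hδ
      (hmom T s hs (by omega)).1 (hmom T (s + k) (by omega) hk).1
      (hmom T s hs (by omega)).2.le (hmom T (s + k) (by omega) hk).2.le
    rwa [(hmean T s hs (by omega)).2, (hmean T (s + k) (by omega) hk).2] at this
  intro η hη
  -- Once `T0 T / T ≥ ρ / 2`, Chebyshev's bound is at most `2 * C / (ρ * M ^ 2)`, which this choice
  -- makes at most `η`; the summand 1 keeps `M` positive.
  set M := √(2 * C / (ρ * η) + 1) with hM
  have hM0 : 0 < M := Real.sqrt_pos.mpr (by positivity)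
  have hM2 : M ^ 2 = 2 * C / (ρ * η) + 1 := Real.sq_sqrt (by positivity)
  refine ⟨M, ?_⟩
  filter_upwards [hT0.eventually (Ioo_mem_nhds (half_lt_self hρ0) hρ1), eventually_gt_atTop 0]
    with T hT hTpos
  have hT' : (0 : ℝ) < T := Nat.cast_pos.mpr hTpos
  obtain ⟨hl, hu⟩ := hT
  rw [lt_div_iff₀ hT'] at hl
  rw [div_lt_iff₀ hT', one_mul] at hu
  have hT0T : T0 T ≤ T := by exact_mod_cast hu.le
  have hn : 0 < T0 T := by
    have : (0 : ℝ) < T0 T := lt_trans (by positivity) hl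
    exact_mod_cast this
  obtain ⟨hi, hle⟩ := integral_sq_sum_le μ (T0 T) (fun t ω => h (Z T t ω)) m hc0 hcs
    (fun t ht => hmean T t (Finset.mem_Icc.mp ht).1 ((Finset.mem_Icc.mp ht).2.trans hT0T))
    (fun s hs t ht => by
      rw [Finset.mem_Icc] at hs ht
      exact integrable_mul_of_integrable_rpow (hhm T s hs.1 (hs.2.trans hT0T))
        (hhm T t ht.1 (ht.2.trans hT0T)) (by linarith : (2 : ℝ) ≤ 2 + δ)
        (hmom T s hs.1 (hs.2.trans hT0T)).1 (hmom T t ht.1 (ht.2.trans hT0T)).1)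
    (fun s k hs hk => hcov T s k hs (hk.trans hT0T))
  have hb : 0 < (T : ℝ) ^ (-(1 / 2) : ℝ) := Real.rpow_pos_of_pos hT' _
  refine (measure_mean_deviation_le μ (T0 T) hn (fun t ω => h (Z T t ω)) m C hi
    (hle.trans_eq (by rw [hC]; ring)) (mul_pos hM0 hb)).trans ?_
  have hb2 : ((T : ℝ) ^ (-(1 / 2) : ℝ)) ^ 2 = (T : ℝ)⁻¹ := by
    rw [← Real.rpow_natCast, ← Real.rpow_mul hT'.le, ← Real.rpow_neg_one]
    norm_num
  rw [mul_pow, hb2, hM2]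
  have hpos : 0 < (T0 T : ℝ) * ((2 * C / (ρ * η) + 1) * (T : ℝ)⁻¹) := by
    have : (0 : ℝ) < T0 T := Nat.cast_pos.mpr hn
    positivity
  rw [div_le_iff₀ hpos]
  have h1 : ρ / 2 ≤ T0 T * (T : ℝ)⁻¹ := by
    rw [← div_eq_mul_inv, le_div_iff₀ hT']; exact hl.le
  calc C ≤ η * (ρ / 2 * (2 * C / (ρ * η) + 1)) := by
        have : η * (ρ / 2 * (2 * C / (ρ * η) + 1)) = C + η * ρ / 2 := by field_simp
        rw [this]
        have : 0 < η * ρ := by positivity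
        linarith
    _ ≤ η * ((T0 T * (T : ℝ)⁻¹) * (2 * C / (ρ * η) + 1)) := by gcongr
    _ = _ := by ring

end SampleMeans

/-! ### From deterministic bounds to statements in probability. -/

section BoundedInProbability

variable {Ω : Type*} [MeasurableSpace Ω] {μ : Measure Ω} [IsProbabilityMeasure μ]

theorem exists_uniform_bound_of_isBigOp {ι : Type*} [Finite ι] {A : ι → ℕ → Ω → ℝ} {b : ℕ → ℝ}
    (hb : ∀ T, 0 ≤ b T) (hA : ∀ i, IsBigOp μ (A i) b) {η : ℝ} (hη : 0 < η) :
    ∃ M : ℝ, 0 < M ∧ ∀ᶠ T in atTop, μ.real {ω | ∃ i, M * b T < |A i T ω|} ≤ η := by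
  have := Fintype.ofFinite ι
  have hpos : 0 < η / (Fintype.card ι + 1) := by positivity
  choose M hM using fun i => hA i _ hpos
  refine ⟨1 + ∑ i, |M i|, by positivity, ?_⟩
  filter_upwards [eventually_all.mpr hM] with T hT
  have hsub : {ω | ∃ i, (1 + ∑ i, |M i|) * b T < |A i T ω|} ⊆
      ⋃ i, {ω | M i * b T < |A i T ω|} := by
    rintro ω ⟨i, hi⟩
    refine Set.mem_iUnion.mpr ⟨i, lt_of_le_of_lt ?_ hi⟩
    refine mul_le_mul_of_nonneg_right ?_ (hb T)
    have := Finset.single_le_sum (f := fun i => |M i|) (fun i _ => abs_nonneg _)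
      (Finset.mem_univ i)
    linarith [le_abs_self (M i)]
  calc _ ≤ μ.real (⋃ i, {ω | M i * b T < |A i T ω|}) := measureReal_mono hsub
    _ ≤ ∑ i, μ.real {ω | M i * b T < |A i T ω|} := measureReal_iUnion_fintype_le _
    _ ≤ ∑ _i : ι, η / (Fintype.card ι + 1) := Finset.sum_le_sum fun i _ => hT i
    _ = Fintype.card ι * (η / (Fintype.card ι + 1)) := by simp
    _ ≤ η := by
        rw [mul_div_assoc', div_le_iff₀ (by positivity)]
        nlinarith

/-- Transfer principle: finitely many errors satisfy their bounds simultaneously outside an event of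
probability `η`, so an implication between bounds that holds pointwise in `ω` passes to `O_p`. Only
monotonicity of the measure is needed, so `R` may be any function. -/
theorem isBigOp_of_bound {ι : Type*} [Finite ι] {A : ι → ℕ → Ω → ℝ} {b b' : ℕ → ℝ}
    (hb : ∀ T, 0 ≤ b T) (hA : ∀ i, IsBigOp μ (A i) b) {R : ℕ → Ω → ℝ}
    (h : ∀ M : ℝ, 0 < M → ∃ M' : ℝ, ∀ᶠ T in atTop, ∀ ω, (∀ i, |A i T ω| ≤ M * b T) →
      |R T ω| ≤ M' * b' T) : IsBigOp μ R b' := by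
  intro η hη
  obtain ⟨M, hM0, hM⟩ := exists_uniform_bound_of_isBigOp hb hA hη
  obtain ⟨M', hM'⟩ := h M hM0
  refine ⟨M', ?_⟩
  filter_upwards [hM, hM'] with T hT hT'
  refine (measureReal_mono fun ω hω => ?_).trans hT
  by_contra hcon
  simp only [Set.mem_ofPred_eq, not_exists, not_lt] at hcon
  exact absurd (hT' ω hcon) (not_le.mpr hω)

theorem tendsto_measure_one_of_bound {ι : Type*} [Finite ι] {A : ι → ℕ → Ω → ℝ} {b : ℕ → ℝ}
    (hb : ∀ T, 0 ≤ b T) (hA : ∀ i, IsBigOp μ (A i) b) {G : ℕ → Set Ω}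
    (h : ∀ M : ℝ, 0 < M → ∀ᶠ T in atTop, ∀ ω, (∀ i, |A i T ω| ≤ M * b T) → ω ∈ G T) :
    Tendsto (fun T => μ.real (G T)) atTop (𝓝 1) := by
  rw [Metric.tendsto_nhds]
  intro η hη
  obtain ⟨M, hM0, hM⟩ := exists_uniform_bound_of_isBigOp hb hA (half_pos hη)
  filter_upwards [hM, h M hM0] with T hT hT'
  have h1 : μ.real (G T)ᶜ ≤ η / 2 := by
    refine (measureReal_mono fun ω hω => ?_).trans hT
    by_contra hcon
    simp only [Set.mem_ofPred_eq, not_exists, not_lt] at hcon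
    exact hω (hT' ω hcon)
  have h2 : 1 ≤ μ.real (G T) + μ.real (G T)ᶜ := by
    have := measureReal_union_le (μ := μ) (G T) (G T)ᶜ
    rwa [Set.union_compl_self, probReal_univ] at this
  have h3 : μ.real (G T) ≤ 1 := measureReal_le_one
  rw [Real.dist_eq, abs_lt]
  constructor <;> linarith

end BoundedInProbability

/-! ### Convergence rate of the pre-intervention sample covariance matrix. -/

section SampleCovariance

open Matrix

/-- The deviation of the untreated outcomes from their mean, as a function of the centred factors
and the errors. -/
def disturbance {N r : ℕ} (Λ : Matrix (Fin N) (Fin r) ℝ) (i : Fin N)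
    (w : (Fin r → ℝ) × (Fin N → ℝ)) : ℝ :=
  Λ.row i ⬝ᵥ w.1 + w.2 i

theorem measurable_disturbance {N r : ℕ} (Λ : Matrix (Fin N) (Fin r) ℝ) (i : Fin N) :
    Measurable (disturbance Λ i) := by
  unfold disturbance dotProduct
  fun_prop

variable {Ω : Type*} {N r : ℕ} [MeasurableSpace Ω] {μ : Measure Ω}

theorem sum_mul_sub_mean (n : ℕ) (hn : 0 < n) (x y : ℕ → ℝ) :
    (n : ℝ)⁻¹ * ∑ t ∈ Finset.Icc 1 n, (x t - (n : ℝ)⁻¹ * ∑ s ∈ Finset.Icc 1 n, x s) *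
      (y t - (n : ℝ)⁻¹ * ∑ s ∈ Finset.Icc 1 n, y s) =
    (n : ℝ)⁻¹ * ∑ t ∈ Finset.Icc 1 n, x t * y t -
      ((n : ℝ)⁻¹ * ∑ s ∈ Finset.Icc 1 n, x s) * ((n : ℝ)⁻¹ * ∑ s ∈ Finset.Icc 1 n, y s) := by
  have hn' : (n : ℝ) ≠ 0 := by positivity
  set a := (n : ℝ)⁻¹ * ∑ s ∈ Finset.Icc 1 n, x s with ha
  set b := (n : ℝ)⁻¹ * ∑ s ∈ Finset.Icc 1 n, y s with hb
  have hx : ∑ s ∈ Finset.Icc 1 n, x s = n * a := by rw [ha, mul_inv_cancel_left₀ hn']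
  have hy : ∑ s ∈ Finset.Icc 1 n, y s = n * b := by rw [hb, mul_inv_cancel_left₀ hn']
  have e : ∀ t, (x t - a) * (y t - b) = x t * y t - a * y t - b * x t + a * b := fun t => by ring
  simp_rw [e]
  rw [Finset.sum_add_distrib, Finset.sum_sub_distrib, Finset.sum_sub_distrib, ← Finset.mul_sum,
    ← Finset.mul_sum, hx, hy]
  simp only [Finset.sum_const, Nat.card_Icc, nsmul_eq_mul, Nat.add_sub_cancel]
  field_simp
  ring

/-- The factor mean is constant before the intervention, so outcomes and disturbances differ by a
constant shift, under which sample covariances are invariant. -/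
theorem preCov_eq_disturbance (P : Panel Ω N r) (hcons : P.Consistency)
    (hmodel : P.LinearFactorModel μ) {α₀ : Fin r → ℝ}
    (hα₀ : ∀ T t, 1 ≤ t → t ≤ T → t ≤ P.T0 T → P.factorMean μ T t = α₀)
    {T : ℕ} (hT0 : 0 < P.T0 T) (hT : P.T0 T ≤ T) (ω : Ω) (i j : Fin N) :
    P.preCov T ω i j =
      (P.T0 T : ℝ)⁻¹ * ∑ t ∈ Finset.Icc 1 (P.T0 T),
        disturbance P.Λ i (P.centred μ T t ω) * disturbance P.Λ j (P.centred μ T t ω) -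
      ((P.T0 T : ℝ)⁻¹ * ∑ t ∈ Finset.Icc 1 (P.T0 T), disturbance P.Λ i (P.centred μ T t ω)) *
        ((P.T0 T : ℝ)⁻¹ * ∑ t ∈ Finset.Icc 1 (P.T0 T), disturbance P.Λ j (P.centred μ T t ω)) := by
  have hn' : (P.T0 T : ℝ) ≠ 0 := by positivity
  have hY : ∀ t ∈ Finset.Icc 1 (P.T0 T), ∀ i, P.Y T t ω i =
      P.Λ.row i ⬝ᵥ α₀ + disturbance P.Λ i (P.centred μ T t ω) := by
    intro t ht i
    obtain ⟨h1, h2⟩ := Finset.mem_Icc.mp ht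
    have hX : P.X T t = 0 := by simp [Panel.X, h2]
    rw [(hcons T t h1 (h2.trans hT) ω i).1 hX, (hmodel T t h1 (h2.trans hT)).2.2.1 ω i]
    simp only [disturbance, Panel.centred, hα₀ T t h1 (h2.trans hT) h2, dotProduct_sub]
    ring
  have hmean : ∀ i, P.preMean T ω i = P.Λ.row i ⬝ᵥ α₀ +
      (P.T0 T : ℝ)⁻¹ * ∑ t ∈ Finset.Icc 1 (P.T0 T), disturbance P.Λ i (P.centred μ T t ω) := by
    intro i
    simp only [Panel.preMean, Pi.smul_apply, Finset.sum_apply, smul_eq_mul]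
    rw [Finset.sum_congr rfl fun t ht => hY t ht i, Finset.sum_add_distrib]
    simp only [Finset.sum_const, Nat.card_Icc, nsmul_eq_mul, Nat.add_sub_cancel]
    rw [mul_add, inv_mul_cancel_left₀ hn']
  rw [← sum_mul_sub_mean (P.T0 T) hT0]
  simp only [Panel.preCov, Matrix.smul_apply, Matrix.sum_apply, Matrix.vecMulVec_apply,
    Pi.sub_apply, smul_eq_mul]
  congr 1
  refine Finset.sum_congr rfl fun t ht => ?_
  rw [hmean i, hmean j, hY t ht i, hY t ht j]
  ring

/-- The centred factor is measurable with respect to the factors and can be pulled out of the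
conditional expectation, where the error has mean zero. -/
theorem integral_centred_factor_mul_error [IsProbabilityMeasure μ] (P : Panel Ω N r)
    (hmodel : P.LinearFactorModel μ) (hmom : P.FactorMoments μ) (k : Fin r) (i : Fin N) :
    ∫ ω, (P.centred μ 1 1 ω).1 k * (P.centred μ 1 1 ω).2 i ∂μ = 0 := by
  obtain ⟨hFm, -, -, -, hε⟩ := hmodel 1 1 le_rfl le_rfl
  obtain ⟨hε2, hF2, -, -⟩ := hmom.2.2.1 1 1 le_rfl le_rfl
  have hm : MeasurableSpace.comap (P.F 1 1) inferInstance ≤ ‹MeasurableSpace Ω› := hFm.comap_le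
  set f : Ω → ℝ := fun ω => (P.centred μ 1 1 ω).1 k with hf
  set g : Ω → ℝ := fun ω => P.ε 1 1 ω i with hg
  have hfm : StronglyMeasurable[MeasurableSpace.comap (P.F 1 1) inferInstance] f := by
    have h1 : Measurable[MeasurableSpace.comap (P.F 1 1) inferInstance] (P.F 1 1) :=
      comap_measurable _
    have h2 : Measurable fun v : Fin r → ℝ => v k - P.factorMean μ 1 1 k := by fun_prop
    exact (h2.comp h1).stronglyMeasurable
  have hf2 : MemLp f 2 μ := (hF2 k).sub (memLp_const (P.factorMean μ 1 1 k))
  have hfg : Integrable (f * g) μ := hf2.integrable_mul (hε2 i)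
  have h1 := condExp_mul_of_stronglyMeasurable_left hfm hfg (hε i).1
  have h2 : μ[f * g | MeasurableSpace.comap (P.F 1 1) inferInstance] =ᵐ[μ] 0 := by
    filter_upwards [h1, (hε i).2] with ω h1 h2
    rw [h1, Pi.mul_apply, h2]
    simp
  have h3 := integral_condExp (μ := μ) (f := f * g) hm
  rw [integral_congr_ae h2] at h3
  have h4 : ∫ ω, (f * g) ω ∂μ = 0 := h3.symm.trans (by simp)
  exact h4

theorem integral_disturbance [IsProbabilityMeasure μ] (P : Panel Ω N r)
    (hmodel : P.LinearFactorModel μ) (hmom : P.FactorMoments μ) :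
    (∀ i, ∫ ω, disturbance P.Λ i (P.centred μ 1 1 ω) ∂μ = 0) ∧
    ∀ i j, ∫ ω, disturbance P.Λ i (P.centred μ 1 1 ω) * disturbance P.Λ j (P.centred μ 1 1 ω) ∂μ =
      (P.Λ * P.Λᵀ + diagonal fun i => P.σ i ^ 2) i j := by
  obtain ⟨hFm, hεm, -, -, hε⟩ := hmodel 1 1 le_rfl le_rfl
  obtain ⟨hε2, hF2, hεcov, hFcov⟩ := hmom.2.2.1 1 1 le_rfl le_rfl
  have hεmean : ∀ i, ∫ ω, P.ε 1 1 ω i ∂μ = 0 := by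
    intro i
    rw [← integral_condExp hFm.comap_le, integral_congr_ae (hε i).2]
    simp
  -- Centred factors and errors form one family of centred, pairwise uncorrelated variables with
  -- variances `v`; each disturbance is a linear combination with coefficients `c`.
  let g : Fin r ⊕ Fin N → Ω → ℝ := Sum.elim
    (fun k ω => P.F 1 1 ω k - P.factorMean μ 1 1 k) (fun i ω => P.ε 1 1 ω i)
  let v : Fin r ⊕ Fin N → ℝ := Sum.elim (fun _ => 1) (fun i => P.σ i ^ 2)
  let c : Fin N → Fin r ⊕ Fin N → ℝ := fun i => Sum.elim (fun k => P.Λ i k)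
    (fun j => if i = j then 1 else 0)
  have hz : ∀ i ω, disturbance P.Λ i (P.centred μ 1 1 ω) = ∑ x, c i x * g x ω := by
    intro i ω
    simp [disturbance, Panel.centred, dotProduct, Fintype.sum_sum_type, c, g]
  have hg2 : ∀ x, MemLp (g x) 2 μ := by
    rintro (k | i)
    · exact (hF2 k).sub (memLp_const _)
    · exact hε2 i
  have hgi : ∀ x, Integrable (g x) μ := fun x => (hg2 x).integrable (by norm_num)
  have hg0 : ∀ x, ∫ ω, g x ω ∂μ = 0 := by
    rintro (k | i)
    · simp only [g, Sum.elim_inl]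
      rw [integral_sub ((hF2 k).integrable (by norm_num)) (integrable_const _)]
      simp [Panel.factorMean]
    · exact hεmean i
  have hgg : ∀ x y, ∫ ω, g x ω * g y ω ∂μ = if x = y then v x else 0 := by
    rintro (k | i) (l | j)
    · have := hFcov k l
      simp only [covariance] at this
      simp only [g, v, Sum.elim_inl, Sum.inl.injEq]
      rw [← Matrix.one_apply (i := k) (j := l)]
      exact this
    · simp only [reduceCtorEq, if_false]
      exact integral_centred_factor_mul_error P hmodel hmom k j
    · simp only [reduceCtorEq, if_false]
      have := integral_centred_factor_mul_error P hmodel hmom l i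
      simpa only [mul_comm, g, Sum.elim_inl, Sum.elim_inr, Panel.centred, Pi.sub_apply] using this
    · have := hεcov i j
      simp only [covariance, hεmean, sub_zero] at this
      simp only [g, v, Sum.elim_inr, Sum.inr.injEq]
      rw [this, Matrix.diagonal_apply]
  refine ⟨fun i => ?_, fun i j => ?_⟩
  · simp_rw [hz]
    rw [integral_finsetSum _ fun x _ => (hgi x).const_mul _]
    simp [integral_const_mul, hg0]
  · simp_rw [hz, Finset.sum_mul_sum]
    have hinteg : ∀ x y, Integrable (fun ω => c i x * g x ω * (c j y * g y ω)) μ := by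
      intro x y
      have := ((hg2 x).integrable_mul (hg2 y)).const_mul (c i x * c j y)
      refine this.congr (.of_forall fun ω => ?_)
      simp only [Pi.mul_apply]
      ring
    rw [integral_finsetSum _ fun x _ => integrable_finsetSum _ fun y _ => hinteg x y]
    have hxy : ∀ x y, ∫ ω, c i x * g x ω * (c j y * g y ω) ∂μ =
        c i x * c j y * if x = y then v x else 0 := by
      intro x y
      rw [← hgg, ← integral_const_mul]
      congr 1
      funext ω
      ring
    have : ∀ x, ∫ ω, ∑ y, c i x * g x ω * (c j y * g y ω) ∂μ = c i x * c j x * v x := by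
      intro x
      rw [integral_finsetSum _ fun y _ => hinteg x y]
      simp [hxy]
    simp_rw [this]
    simp only [Fintype.sum_sum_type, c, v, Sum.elim_inl, Sum.elim_inr, Matrix.add_apply,
      Matrix.mul_apply, Matrix.transpose_apply, mul_one, ite_mul, one_mul, zero_mul,
      Finset.sum_ite_eq, Finset.mem_univ, if_true, Matrix.diagonal_apply]
    by_cases hij : i = j
    · simp [hij]
    · simp [hij, Ne.symm hij]

theorem memLp_disturbance (P : Panel Ω N r) {q : ENNReal}
    (h1 : ∀ k, MemLp (fun ω => (P.centred μ 1 1 ω).1 k) q μ)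
    (h2 : ∀ i, MemLp (fun ω => (P.centred μ 1 1 ω).2 i) q μ) (i : Fin N) :
    MemLp (fun ω => disturbance P.Λ i (P.centred μ 1 1 ω)) q μ := by
  unfold disturbance dotProduct
  exact (memLp_finsetSum _ fun k _ => (h1 k).const_mul _).add (h2 i)

/-- Moments of order `4 + 2 * δ` of the disturbances thus give moments of order `2 + δ` of their
products, as the covariance inequality requires. -/
theorem abs_mul_rpow_le (x y : ℝ) {p : ℝ} (hp : 0 ≤ p) :
    |x * y| ^ p ≤ |x| ^ (2 * p) + |y| ^ (2 * p) := by
  have key : ∀ u v : ℝ, |u| ≤ |v| → |u * v| ^ p ≤ |v| ^ (2 * p) := by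
    intro u v h
    rw [mul_comm 2 p, Real.rpow_mul (abs_nonneg v), abs_mul,
      Real.mul_rpow (abs_nonneg u) (abs_nonneg v), Real.rpow_two, sq]
    exact mul_le_mul_of_nonneg_right (Real.rpow_le_rpow (abs_nonneg u) h hp) (by positivity)
  rcases le_total |x| |y| with h | h
  · exact (key x y h).trans (le_add_of_nonneg_left (by positivity))
  · rw [mul_comm x y]
    exact (key y x h).trans (le_add_of_nonneg_right (by positivity))

theorem identDistrib_centred {P : Panel Ω N r} (hmix : P.StationaryMixing μ) {T t : ℕ}
    (h1 : 1 ≤ t) (h2 : t ≤ T) : IdentDistrib (P.centred μ T t) (P.centred μ 1 1) μ μ := by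
  have h := (hmix.1 1 T 1 (t - 1) 0 (by omega) (by omega)).comp
    (measurable_pi_apply (0 : Fin 1))
  have e : t - 1 + 1 = t := by omega
  simpa [Function.comp_def, e] using h

theorem measurable_centred {P : Panel Ω N r} (hmodel : P.LinearFactorModel μ) {T t : ℕ}
    (h1 : 1 ≤ t) (h2 : t ≤ T) : Measurable (P.centred μ T t) :=
  ((hmodel T t h1 h2).1.sub_const _).prodMk (hmodel T t h1 h2).2.1

/-- An entry is a mean of products minus a product of means. The first has the root-`T` rate around
its expectation; the second is a product of two centred means at that rate, hence of smaller order.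
-/
theorem isBigOp_preCov [IsProbabilityMeasure μ] (P : Panel Ω N r) {ρ : ℝ} (hρ0 : 0 < ρ)
    (hρ1 : ρ < 1) (hT0 : Tendsto (fun T : ℕ => (P.T0 T : ℝ) / (T : ℝ)) atTop (𝓝 ρ))
    (hcons : P.Consistency) (hmodel : P.LinearFactorModel μ) (hmom : P.FactorMoments μ)
    (hmix : P.StationaryMixing μ) (i j : Fin N) :
    IsBigOp μ (fun T ω => P.preCov T ω i j - (P.Λ * P.Λᵀ + diagonal fun i => P.σ i ^ 2) i j)
      (fun T => (T : ℝ) ^ (-(1 / 2) : ℝ)) := by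
  obtain ⟨δ, hδ, hLp, hsum⟩ := hmix.2
  obtain ⟨hmean, hcov⟩ := integral_disturbance P hmodel hmom
  have hz : ∀ i, Integrable
      (fun ω => |disturbance P.Λ i (P.centred μ 1 1 ω)| ^ (2 * (2 + δ))) μ := by
    intro i
    have h := (memLp_disturbance P (hLp 1 1 le_rfl le_rfl).1 (hLp 1 1 le_rfl le_rfl).2
      i).integrable_norm_rpow (by simp; linarith) (by simp)
    rw [ENNReal.toReal_ofReal (by linarith)] at h
    rw [show 2 * (2 + δ) = 4 + 2 * δ by ring]
    exact h
  have hmeas := fun i => (measurable_disturbance P.Λ i).comp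
    (measurable_centred (P := P) hmodel (le_refl 1) (le_refl 1))
  have hz2 : ∀ i j, Integrable (fun ω => |disturbance P.Λ i (P.centred μ 1 1 ω) *
      disturbance P.Λ j (P.centred μ 1 1 ω)| ^ (2 + δ)) μ := by
    intro i j
    refine ((hz i).add (hz j)).mono' ?_ (.of_forall fun ω => ?_)
    · have := (((hmeas i).mul (hmeas j)).abs.pow_const (2 + δ)).aestronglyMeasurable (μ := μ)
      exact this
    · rw [Real.norm_of_nonneg (by positivity)]
      exact abs_mul_rpow_le _ _ (by linarith)
  have hz1 : ∀ i, Integrable (fun ω => |disturbance P.Λ i (P.centred μ 1 1 ω)| ^ (2 + δ)) μ := by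
    intro i
    refine ((integrable_const (1 : ℝ)).add (hz i)).mono' ?_ (.of_forall fun ω => ?_)
    · exact ((hmeas i).abs.pow_const (2 + δ)).aestronglyMeasurable
    · rw [Real.norm_of_nonneg (by positivity)]
      have := abs_mul_rpow_le (disturbance P.Λ i (P.centred μ 1 1 ω)) 1
        (by linarith : 0 ≤ 2 + δ)
      simp only [mul_one, abs_one, Real.one_rpow] at this
      simp only [Pi.add_apply]
      linarith
  have hmain := fun (h : (Fin r → ℝ) × (Fin N → ℝ) → ℝ) (hh : Measurable h) hinteg =>
    isBigOp_sample_mean μ (P.centred μ) hδ (fun T t h1 h2 => measurable_centred hmodel h1 h2)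
      (fun T t h1 h2 => identDistrib_centred hmix h1 h2) hsum h hh hinteg P.T0 hρ0 hρ1 hT0
  have hA1 := fun i => hmain _ (measurable_disturbance P.Λ i) (hz1 i)
  have hA2 := hmain _ ((measurable_disturbance P.Λ i).mul (measurable_disturbance P.Λ j))
    (hz2 i j)
  simp only [hmean, sub_zero] at hA1
  simp only [Pi.mul_apply, hcov] at hA2
  obtain ⟨α₀, hα₀⟩ := hmom.1
  let A : Option (Fin N) → ℕ → Ω → ℝ := fun o => o.elim
    (fun T ω => (P.T0 T : ℝ)⁻¹ * ∑ t ∈ Finset.Icc 1 (P.T0 T),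
        disturbance P.Λ i (P.centred μ T t ω) * disturbance P.Λ j (P.centred μ T t ω) -
      (P.Λ * P.Λᵀ + diagonal fun i => P.σ i ^ 2) i j)
    (fun i T ω => (P.T0 T : ℝ)⁻¹ *
      ∑ t ∈ Finset.Icc 1 (P.T0 T), disturbance P.Λ i (P.centred μ T t ω))
  have hA : ∀ o, IsBigOp μ (A o) (fun T => (T : ℝ) ^ (-(1 / 2) : ℝ)) := by
    rintro (_ | i)
    · exact hA2
    · exact hA1 i
  refine isBigOp_of_bound (fun T => Real.rpow_nonneg (Nat.cast_nonneg T) _) hA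
    fun M hM => ⟨M + M * M, ?_⟩
  filter_upwards [hT0.eventually (Ioo_mem_nhds hρ0 hρ1), eventually_ge_atTop 1] with T hT hT1 ω hω
  have hT' : (1 : ℝ) ≤ T := by exact_mod_cast hT1
  have hT0' : (0 : ℝ) < T := by linarith
  have hu : P.T0 T ≤ T := by
    have := hT.2
    rw [div_lt_one hT0'] at this
    exact_mod_cast this.le
  have hl : 0 < P.T0 T := by
    have h0 : (0 : ℝ) < P.T0 T := by
      by_contra hcon
      exact absurd hT.1 (not_lt.mpr (div_nonpos_of_nonpos_of_nonneg (not_lt.mp hcon) hT0'.le))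
    exact_mod_cast h0
  rw [preCov_eq_disturbance P hcons hmodel hα₀ hl hu ω i j]
  have hb0 : 0 ≤ (T : ℝ) ^ (-(1 / 2) : ℝ) := by positivity
  have hb1 : (T : ℝ) ^ (-(1 / 2) : ℝ) ≤ 1 :=
    Real.rpow_le_one_of_one_le_of_nonpos hT' (by norm_num)
  have h1 := hω none
  have h2 := hω (some i)
  have h3 := hω (some j)
  simp only [A, Option.elim_none, Option.elim_some] at h1 h2 h3
  set b := (T : ℝ) ^ (-(1 / 2) : ℝ)
  have h4 := mul_le_mul h2 h3 (abs_nonneg _) (by positivity)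
  rw [← abs_mul] at h4
  have h5 : M * b * (M * b) ≤ M * M * b := by
    have : M * M * b * b ≤ M * M * b * 1 := mul_le_mul_of_nonneg_left hb1 (by positivity)
    linarith
  rw [add_mul]
  rw [abs_le] at h1 h4 ⊢
  constructor <;> linarith

end SampleCovariance

/-! ### Size of the threshold and the combined deterministic bound. -/

open Matrix

theorem tendsto_sqrt_log_atTop {N : ℕ} (hN : 0 < N) :
    Tendsto (fun T : ℕ => √(2 * Real.log ((N : ℝ) * (T : ℝ)))) atTop atTop := by
  have hN' : (0 : ℝ) < N := Nat.cast_pos.mpr hN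
  exact Real.tendsto_sqrt_atTop.comp ((Real.tendsto_log_atTop.comp
    (tendsto_natCast_atTop_atTop.const_mul_atTop hN')).const_mul_atTop two_pos)

/-- With `x = N * T` the expression is `N ^ d` times the square root of `2 * log x / x ^ (2 * d)`,
and logarithms grow more slowly than powers. -/
theorem tendsto_sqrt_log_mul_rpow_neg {N : ℕ} (hN : 0 < N) {d : ℝ} (hd : 0 < d) :
    Tendsto (fun T : ℕ => √(2 * Real.log ((N : ℝ) * (T : ℝ))) * (T : ℝ) ^ (-d)) atTop (𝓝 0) := by
  have hN' : (0 : ℝ) < N := Nat.cast_pos.mpr hN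
  have hx : Tendsto (fun x : ℝ => √(2 * (Real.log x / x ^ (2 * d)))) atTop (𝓝 0) := by
    have h := (isLittleO_log_rpow_atTop (r := 2 * d) (by positivity)).tendsto_div_nhds_zero
    have h2 := (Real.continuous_sqrt.tendsto _).comp (h.const_mul 2)
    simpa [Function.comp_def] using h2
  have hT : Tendsto (fun T : ℕ => (N : ℝ) * (T : ℝ)) atTop atTop :=
    tendsto_natCast_atTop_atTop.const_mul_atTop hN'
  have h := (hx.comp hT).const_mul ((N : ℝ) ^ d)
  rw [mul_zero] at h
  refine h.congr' ?_
  filter_upwards [eventually_gt_atTop 0] with T hTpos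
  have hT' : (0 : ℝ) < T := Nat.cast_pos.mpr hTpos
  have hNT : (0 : ℝ) < (N : ℝ) * T := by positivity
  have e : ((N : ℝ) * T) ^ (2 * d) = (((N : ℝ) * T) ^ d) ^ 2 := by
    rw [← Real.rpow_natCast, ← Real.rpow_mul hNT.le, mul_comm 2 d]
    norm_num
  simp only [Function.comp_apply]
  rw [e, mul_div_assoc', Real.sqrt_div' _ (sq_nonneg _), Real.sqrt_sq (by positivity),
    Real.mul_rpow hN'.le hT'.le, Real.rpow_neg hT'.le]
  field_simp

/-- Deterministic error bound for the estimated effects in terms of the errors of the sample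
covariance matrix and of the trend estimator. -/
theorem exists_betaHat_bound {N r : ℕ} (Λ : Matrix (Fin N) (Fin r) ℝ) (s : Fin N → ℝ)
    (hs : ∀ i, 0 < s i)
    (hAR : ∀ i : Fin N, ∃ A B : Finset (Fin N), i ∉ A ∧ i ∉ B ∧ Disjoint A B ∧
      A.card = r ∧ B.card = r ∧
      LinearIndependent ℝ (fun j : A => Λ.row j) ∧ LinearIndependent ℝ (fun j : B => Λ.row j))
    (K : ℝ) :
    ∃ C ε₀ : ℝ, 0 < C ∧ 0 < ε₀ ∧ ∀ (S : Matrix (Fin N) (Fin N) ℝ) (L : Matrix (Fin N) (Fin r) ℝ)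
      (ψ y β : Fin N → ℝ) (a α : Fin r → ℝ) (ε : ℝ) (T : Finset (Fin N)),
      0 ≤ ε → ε ≤ ε₀ → (∀ k, |α k| ≤ K) → (∀ i ∈ T, β i = 0) → N / 2 + r ≤ T.card →
      (∀ S ⊆ T, T.card + N / 2 + 1 ≤ N + S.card →
        Submodule.span ℝ (Λ.row '' (S : Set (Fin N))) = ⊤) →
      (∀ i j, |S i j - (Λ * Λᵀ + diagonal s) i j| ≤ ε) →
      ((∃ (L : Matrix (Fin N) (Fin r) ℝ) (ψ : Fin N → ℝ), IsFactorMLE S L ψ) →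
        IsFactorMLE S L ψ) →
      (∀ i, |y i - (β + Λ.mulVec α) i| ≤ ε) → IsLTS L y a →
      ∀ i, |betaHat L y a i - β i| ≤ C * ε := by
  -- For `r = 0` only `N / 2` controls are guaranteed, one short of what trimming needs; but then
  -- there is nothing to regress on and the fitted effects are `y` itself. For `r ≥ 1` the majority
  -- condition provides `N / 2 + 1` controls.
  rcases Nat.eq_zero_or_pos r with rfl | hr
  · refine ⟨1, 1, one_pos, one_pos, ?_⟩
    intro S L ψ y β a α ε T _ _ _ _ _ _ _ _ hy _ i
    have h := hy i
    simpa [betaHat, Matrix.mulVec, dotProduct] using h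
  obtain ⟨C₁, ε₁, hC₁, hε₁, h₁⟩ := exists_mle_bound Λ s hs hAR
  obtain ⟨C₂, ε₂, hC₂, hε₂, h₂⟩ := exists_lts_bound Λ K
  refine ⟨C₂ * (C₁ + 1), min ε₁ (ε₂ / (C₁ + 1)), by positivity, by positivity, ?_⟩
  intro S L ψ y β a α ε T hε0 hε hα hβ hT hgp hS hL hy hLTS i
  obtain ⟨hex, hmle⟩ := h₁ S ε hε0 (hε.trans (min_le_left _ _)) hS
  obtain ⟨Q, hQ, hLQ⟩ := hmle L ψ (hL hex)
  have hε2 : (C₁ + 1) * ε ≤ ε₂ := by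
    have := hε.trans (min_le_right _ _)
    rw [le_div_iff₀ (by positivity)] at this
    linarith
  have hC1ε : 0 ≤ C₁ * ε := by positivity
  rw [mul_assoc]
  exact h₂ L Q y β a α ((C₁ + 1) * ε) T hQ (by positivity) hε2 hα hβ (by omega) hgp
    (fun i k => (hLQ i k).trans (by linarith)) (fun i => (hy i).trans (by linarith)) hLTS i

/-- Thresholding recovers the support of `β` once the estimation error is below the threshold and
the threshold is small compared with the nonzero entries. -/
theorem selected_eq_of_bounds {N r : ℕ} (L : Matrix (Fin N) (Fin r) ℝ) (y β : Fin N → ℝ)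
    (a : Fin r → ℝ) (T : Finset (Fin N)) (hT : ∀ i, i ∈ T ↔ β i = 0) {thr e c : ℝ}
    (hc : ∀ i, β i ≠ 0 → c ≤ |β i|) (he : ∀ i, |betaHat L y a i - β i| ≤ e) (h1 : e ≤ thr)
    (h2 : thr + e < c) : selected L y a thr = T := by
  ext i
  have hb : y i - L.row i ⬝ᵥ a = betaHat L y a i := rfl
  simp only [selected, Finset.mem_filter, Finset.mem_univ, true_and, hb, hT i]
  have hi := he i
  constructor
  · intro h
    by_contra hne
    have h3 := hc i hne
    have h4 := abs_sub_abs_le_abs_sub (β i) (betaHat L y a i)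
    rw [abs_sub_comm] at h4
    linarith
  · intro h0
    rw [h0, sub_zero] at hi
    exact hi.trans h1

end SCI

/-! ### Assembly of the theorem. -/

theorem theorem2 {Ω : Type*} [MeasurableSpace Ω] (μ : Measure Ω) [IsProbabilityMeasure μ]
    {N r : ℕ} (P : SCI.Panel Ω N r)
    -- the numbers of pre- and post-intervention periods are comparable
    (ρ : ℝ) (hρ0 : 0 < ρ) (hρ1 : ρ < 1)
    (hT0 : Tendsto (fun T : ℕ => (P.T0 T : ℝ) / (T : ℝ)) atTop (𝓝 ρ))
    -- the model
    (hcons : P.Consistency) (hmodel : P.LinearFactorModel μ) (hmom : P.FactorMoments μ)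
    (hmaj : P.MajorityControls) (hmix : P.StationaryMixing μ)
    (hAR : P.AndersonRubin) (hgp : P.GeneralPosition)
    -- the post-intervention time `t`, which moves with the horizon; the factor mean at `t` stays
    -- bounded and the nonzero effects at `t` stay away from zero
    (t : ℕ → ℕ) (ht : ∀ᶠ T in atTop, P.T0 T < t T ∧ t T ≤ T)
    (hα : ∃ K : ℝ, ∀ᶠ T in atTop, ∀ k, |P.factorMean μ T (t T) k| ≤ K)
    (hβ : ∃ c : ℝ, 0 < c ∧ ∀ᶠ T in atTop, ∀ i, P.β T (t T) i ≠ 0 → c ≤ |P.β T (t T) i|)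
    -- the trend estimator
    (d : ℝ) (hd0 : 0 < d) (hd1 : d ≤ 1 / 2)
    (τhat : ℕ → ℕ → Ω → Fin N → ℝ) (hτm : ∀ T s, Measurable (τhat T s))
    (hτ : ∀ i, SCI.IsBigOp μ (fun T ω => τhat T (t T) ω i - P.trend μ T (t T) i)
      (fun T => (T : ℝ) ^ (-d)))
    -- factor analysis of the pre-intervention data
    (Λhat : ℕ → Ω → Matrix (Fin N) (Fin r) ℝ) (ψhat : ℕ → Ω → Fin N → ℝ)
    (hΛm : ∀ T i k, Measurable fun ω => Λhat T ω i k)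
    (hΛ : ∀ T ω, (∃ L ψ, SCI.IsFactorMLE (r := r) (P.preCov T ω) L ψ) →
      SCI.IsFactorMLE (P.preCov T ω) (Λhat T ω) (ψhat T ω))
    -- least trimmed squares at each post-intervention time
    (αhat : ℕ → ℕ → Ω → Fin r → ℝ) (hαm : ∀ T s, Measurable (αhat T s))
    (hLTS : ∀ T s, P.T0 T < s → s ≤ T → ∀ ω,
      SCI.IsLTS (Λhat T ω) (τhat T s ω) (αhat T s ω)) :
    (∀ i, SCI.IsBigOp μ
      (fun T ω => SCI.betaHat (Λhat T ω) (τhat T (t T) ω) (αhat T (t T) ω) i - P.β T (t T) i)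
      (fun T => (T : ℝ) ^ (-d))) ∧
    Tendsto (fun T : ℕ => μ.real {ω |
      SCI.selected (Λhat T ω) (τhat T (t T) ω) (αhat T (t T) ω)
        (√(2 * Real.log ((N : ℝ) * (T : ℝ))) * P.sigmaHat T ω / (T : ℝ) ^ d) =
          P.controls T (t T)}) atTop (𝓝 1) := by
  obtain ⟨K, hK⟩ := hα
  obtain ⟨c, hc0, hc⟩ := hβ
  have hs : ∀ i, 0 < P.σ i ^ 2 := fun i => pow_pos (hmom.2.1 i) 2
  obtain ⟨C, ε₀, hC, hε₀, hbound⟩ :=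
    SCI.exists_betaHat_bound P.Λ (fun i => P.σ i ^ 2) hs hAR K
  set V := P.Λ * P.Λ.transpose + Matrix.diagonal fun i => P.σ i ^ 2 with hV
  let A : Fin N ⊕ (Fin N × Fin N) → ℕ → Ω → ℝ := Sum.elim
    (fun i T ω => τhat T (t T) ω i - P.trend μ T (t T) i)
    (fun p T ω => P.preCov T ω p.1 p.2 - V p.1 p.2)
  have hb : ∀ T : ℕ, 0 ≤ (T : ℝ) ^ (-d) := fun T => Real.rpow_nonneg (Nat.cast_nonneg T) _
  have hA : ∀ x, SCI.IsBigOp μ (A x) (fun T => (T : ℝ) ^ (-d)) := by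
    rintro (i | ⟨i, j⟩)
    · exact hτ i
    -- The rate `T ^ (-1/2)` is weakened to `T ^ (-d)`, by `d ≤ 1/2`, so that both error sources
    -- share one rate.
    · refine SCI.isBigOp_of_bound (ι := Unit)
        (fun T => Real.rpow_nonneg (Nat.cast_nonneg T) _)
        (fun _ => SCI.isBigOp_preCov P hρ0 hρ1 hT0 hcons hmodel hmom hmix i j)
        fun M hM => ⟨M, ?_⟩
      filter_upwards [eventually_ge_atTop 1] with T hT1 ω hω
      have hT' : (1 : ℝ) ≤ T := by exact_mod_cast hT1
      exact (hω ()).trans (mul_le_mul_of_nonneg_left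
        (Real.rpow_le_rpow_of_exponent_le hT' (by linarith)) hM.le)
  have hlim : Tendsto (fun T : ℕ => (T : ℝ) ^ (-d)) atTop (𝓝 0) :=
    (tendsto_rpow_neg_atTop hd0).comp tendsto_natCast_atTop_atTop
  have hsmall : ∀ M e : ℝ, 0 < e → ∀ᶠ T : ℕ in atTop, M * (T : ℝ) ^ (-d) < e := by
    intro M e he
    have := hlim.const_mul M
    rw [mul_zero] at this
    exact this.eventually_lt_const he
  have hmain : ∀ M : ℝ, 0 < M → ∀ᶠ T in atTop, ∀ ω, (∀ x, |A x T ω| ≤ M * (T : ℝ) ^ (-d)) →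
      ∀ i, |SCI.betaHat (Λhat T ω) (τhat T (t T) ω) (αhat T (t T) ω) i - P.β T (t T) i| ≤
        C * M * (T : ℝ) ^ (-d) := by
    intro M hM
    filter_upwards [ht, hK, hsmall M ε₀ hε₀] with T htT hKT hε ω hω
    rw [mul_assoc]
    exact hbound (P.preCov T ω) (Λhat T ω) (ψhat T ω) (τhat T (t T) ω) (P.β T (t T))
      (αhat T (t T) ω) (P.factorMean μ T (t T)) (M * (T : ℝ) ^ (-d)) (P.controls T (t T))
      (mul_nonneg hM.le (hb T)) hε.le hKT
      (fun i hi => by simpa [SCI.Panel.controls] using hi) (hmaj T (t T) htT.1 htT.2)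
      (hgp T (t T) htT.1 htT.2) (fun i j => hω (Sum.inr (i, j))) (hΛ T ω)
      (fun i => hω (Sum.inl i)) (hLTS T (t T) htT.1 htT.2 ω)
  refine ⟨fun i => SCI.isBigOp_of_bound hb hA fun M hM => ⟨C * M, ?_⟩, ?_⟩
  · filter_upwards [hmain M hM] with T hT ω hω
    exact hT ω hω i
  · refine SCI.tendsto_measure_one_of_bound hb hA fun M hM => ?_
    rcases Nat.eq_zero_or_pos N with hN | hN
    · subst hN
      exact .of_forall fun T ω _ => Subsingleton.elim _ _
    obtain ⟨a, b, ε₁, ha, hb', hε₁, hσ⟩ :=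
      SCI.exists_sigmaHat_bounds (Ω := Ω) hN P.Λ (fun i => P.σ i ^ 2) hs
    -- The largest possible threshold plus the estimation error falls below the smallest nonzero
    -- effect. The companion condition, that even with `sigmaHat` at its lower bound `a` the
    -- threshold exceeds the error `C * M * T ^ (-d)`, is the bound `C * M / a` on the logarithmic
    -- factor.
    have hthr : ∀ᶠ T : ℕ in atTop, √(2 * Real.log ((N : ℝ) * (T : ℝ))) * (T : ℝ) ^ (-d) * b +
        C * M * (T : ℝ) ^ (-d) < c := by
      have h := ((SCI.tendsto_sqrt_log_mul_rpow_neg hN hd0).mul_const b).add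
        (hlim.const_mul (C * M))
      rw [zero_mul, mul_zero, add_zero] at h
      exact h.eventually_lt_const hc0
    filter_upwards [hmain M hM, hc, hsmall M ε₁ hε₁, hthr,
      (SCI.tendsto_sqrt_log_atTop hN).eventually_ge_atTop (C * M / a)] with T hT hcT hε hthrT hlog
      ω hω
    obtain ⟨hσa, hσb⟩ := hσ P T ω fun i j => (hω (Sum.inr (i, j))).trans hε.le
    have hdiv : √(2 * Real.log ((N : ℝ) * (T : ℝ))) * P.sigmaHat T ω / (T : ℝ) ^ d =
        √(2 * Real.log ((N : ℝ) * (T : ℝ))) * P.sigmaHat T ω * (T : ℝ) ^ (-d) := by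
      rw [Real.rpow_neg (Nat.cast_nonneg T), div_eq_mul_inv]
    rw [hdiv]
    refine SCI.selected_eq_of_bounds _ _ (P.β T (t T)) _ _
      (fun i => by simp [SCI.Panel.controls]) hcT (hT ω hω) ?_ ?_
    · rw [div_le_iff₀ ha] at hlog
      refine mul_le_mul_of_nonneg_right (hlog.trans ?_) (hb T)
      exact mul_le_mul_of_nonneg_left hσa (Real.sqrt_nonneg _)
    · refine lt_of_le_of_lt ?_ hthrT
      have : √(2 * Real.log ((N : ℝ) * (T : ℝ))) * (T : ℝ) ^ (-d) * P.sigmaHat T ω ≤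
          √(2 * Real.log ((N : ℝ) * (T : ℝ))) * (T : ℝ) ^ (-d) * b :=
        mul_le_mul_of_nonneg_left hσb (mul_nonneg (Real.sqrt_nonneg _) (hb T))
      linarith
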